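/- Let $R$ be a finite commutative chain ring with unity whose maximal ideal $\langle\gamma\rangle$ is generated by an element $\gamma$ of nilpotency index $2$, and let $\overline{R}=R/\langle\gamma\rangle$ be its residue field, of order $p^m$ with $p$ prime and $m\ge 1$; write $r\mapsto\overline r$ for the reduction map. Let $\zeta\in R$ have multiplicative order $p^m-1$ and let $\mathcal T=\{0,1,\zeta,\dots,\zeta^{p^m-2}\}$ be the Teichmüller set. Let $n,s\ge1$ be integers with $\gcd(n,p)=1$, and let $\alpha=\alpha_0^{p^s}\in\mathcal T\setminus\{0\}$, where $\alpha_0\in\mathcal T$ is such that $x^n-\alpha_0$ is irreducible over $R$. Put $\mathcal K=R[x]/\langle x^{np^s}-\alpha\rangle$ and $f=x^n-\alpha_0$, and let $\mathcal C$ be an $\alpha$-constacyclic code of length $np^s$ over $R$, i.e. an ideal of $\mathcal K$. The Hamming weight of an element of $\mathcal K$ is the number of non-zero coefficients of its representative of degree less than $np^s$; the Hamming distance $d_H(\mathcal C)$ is the least Hamming weight of a non-zero element of $\mathcal C$, with $d_H(\{0\})=0$. The same conventions apply over $\overline R$. For $\omega,t\ge0$ and $G\in\mathcal K$ let $\kappa=\kappa(\omega,t,G)$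 be the smallest integer $k\ge0$ with $\gamma f^{k}\in\langle f^\omega+\gamma f^tG\rangle$. For an integer $b\ge1$, call $G\in\mathcal K$ a *reduced unit of length $b$* if $G$ is a unit of $\mathcal K$ of the form $\sum_{i=0}^{b-1}a_i(x)f^i$, where each $a_i(x)$ is either $0$ or of degree less than $n$, with all coefficients in $\mathcal T$. Then $\mathcal C$ is of at least one of the following types: * Type I: $\mathcal C=\{0\}$ or $\mathcal C=\mathcal K$. * Type II: $\mathcal C=\langle\gamma f^\tau\rangle$ with $0\le\tau<p^s$. * Type III: $\mathcal C=\langle f^\omega+\gamma f^tG\rangle$ with $0<\omega<p^s$, $\kappa\le\omega$, and either $G=0$, or $0\le t<\kappa$ and $G$ is a reduced unit of length $\kappa-t$. * Type IV: $\mathcal C=\langle f^\omega+\gamma f^tG,\ \gamma f^\mu\rangle$ with $0\le\mu<\kappa\le\omega<p^s$, and either $G=0$, or $0\le t<\mu$ and $G$ is a reduced unit of length $\mu-t$. For an integer $j$ with $1\le j\le p^s-1$ put $$D(j)=\begin{cases}\ell+2 & \text{if } \ell p^{s-1}+1\le j\le(\ell+1)p^{s-1}\text{ with }0\le\ell\le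 p-2;\\ (i+1)p^k & \text{if } p^s-p^{s-k}+(i-1)p^{s-k-1}+1\le j\le p^s-p^{s-k}+ip^{s-k-1}\\ & \text{with }1\le i\le p-1\text{ and }1\le k\le s-1.\end{cases}$$ (These ranges are disjoint and cover $1\le j\le p^s-1$.) The Hamming distance of $\mathcal C$ is given as follows. * (a) If $\mathcal C=\{0\}$, then $d_H(\mathcal C)=0$. * (b) If $\mathcal C=\langle1\rangle$, then $d_H(\mathcal C)=1$. * (c) If $\mathcal C=\langle\gamma f^\tau\rangle$ is of Type II, then $d_H(\mathcal C)=1$ if $\tau=0$, and $d_H(\mathcal C)=D(\tau)$ if $\tau\ge1$. * (d) If $\mathcal C=\langle f^\omega+\gamma f^tG\rangle$ is of Type III, then $\kappa\ge1$ and $d_H(\mathcal C)=D(\kappa)$. * (e) If $\mathcal C=\langle f^\omega+\gamma f^tG,\gamma f^\mu\rangle$ is of Type IV, then $d_H(\mathcal C)=1$ if $\mu=0$, and $d_H(\mathcal C)=D(\mu)$ if $\mu\ge1$. Moreover, in cases (c), (d), (e), with $j=\tau,\kappa,\mu$ respectively, $d_H(\mathcal C)$ equals the Hamming distance of the $\overline{\alpha}$-constacyclic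 code $\langle(x^n-\overline{\alpha_0})^{j}\rangle\subseteq\overline R[x]/\langle x^{np^s}-\overline\alpha\rangle$ of length $np^s$ over $\overline R$. -/

import Mathlib

open Polynomial

namespace ConstacyclicCode

/-- `R` is a chain ring (its ideals are linearly ordered by inclusion) whose maximal ideal is
generated by `γ`, an element of nilpotency index `e`. -/
structure IsChainRingWith (R : Type*) [CommRing R] [IsLocalRing R] (γ : R) (e : ℕ) : Prop where
  chain : ∀ I J : Ideal R, I ≤ J ∨ J ≤ I
  maximalIdeal_eq : IsLocalRing.maximalIdeal R = Ideal.span {γ}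
  nilpotencyClass_eq : nilpotencyClass γ = e

/-- The Teichmüller set `{0, 1, ζ, …, ζ ^ (orderOf ζ - 1)}` attached to `ζ`. -/
def teichmullerSet {R : Type*} [CommRing R] (ζ : R) : Set R :=
  {r | r = 0 ∨ ∃ i < orderOf ζ, r = ζ ^ i}

/-- The set `𝒫_k(S)` of polynomials with all coefficients in `S` (where `0 ∈ S`) that are zero or
have degree less than `k`. -/
def boundedPolys {R : Type*} [CommRing R] (k : ℕ) (S : Set R) : Set R[X] :=
  {g | (∀ i, g.coeff i ∈ S) ∧ (g = 0 ∨ g.natDegree < k)}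

/-- The ring `R[x] / ⟨x ^ N - l⟩`; its ideals are the `l`-constacyclic codes of length `N`. -/
abbrev CodeRing {R : Type*} [CommRing R] (N : ℕ) (l : R) : Type _ :=
  AdjoinRoot (X ^ N - C l : R[X])

/-- The representative of degree less than `N` of a class in `R[x] / ⟨x ^ N - l⟩`. -/
noncomputable def codewordPoly {R : Type*} [CommRing R] {N : ℕ} {l : R} (c : CodeRing N l) :
    R[X] :=
  Function.surjInv AdjoinRoot.mk_surjective c %ₘ (X ^ N - C l)

/-- The polynomial chosen above does represent the class, has degree less than `N`, and is the
only such polynomial. -/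
theorem codewordPoly_eq_iff {R : Type*} [CommRing R] [Nontrivial R] {N : ℕ} (hN : N ≠ 0) {l : R}
    (c : CodeRing N l) (g : R[X]) :
    codewordPoly c = g ↔ (g.degree < N ∧ AdjoinRoot.mk (X ^ N - C l) g = c) := by
  have hm : (X ^ N - C l : R[X]).Monic := monic_X_pow_sub_C l hN
  have hd : (X ^ N - C l : R[X]).degree = N := degree_X_pow_sub_C (Nat.pos_of_ne_zero hN) l
  have hc : AdjoinRoot.mk (X ^ N - C l) (Function.surjInv AdjoinRoot.mk_surjective c) = c :=
    Function.surjInv_eq AdjoinRoot.mk_surjective c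
  constructor
  · rintro rfl
    refine ⟨hd ▸ degree_modByMonic_lt _ hm, ?_⟩
    conv_rhs => rw [← hc]
    rw [AdjoinRoot.mk_eq_mk, codewordPoly]
    refine ⟨-(Function.surjInv AdjoinRoot.mk_surjective c /ₘ (X ^ N - C l)), ?_⟩
    have h := modByMonic_add_div (Function.surjInv AdjoinRoot.mk_surjective c) (X ^ N - C l)
    linear_combination h
  · rintro ⟨h1, h2⟩
    have h3 : AdjoinRoot.mk (X ^ N - C l) (Function.surjInv AdjoinRoot.mk_surjective c) =
        AdjoinRoot.mk (X ^ N - C l) g := by rw [hc, h2]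
    rw [AdjoinRoot.mk_eq_mk] at h3
    rw [codewordPoly, (modByMonic_eq_of_dvd_sub hm h3), (modByMonic_eq_self_iff hm)]
    rwa [hd]

/-- The Hamming weight of a codeword: the number of non-zero coefficients of its representative of
degree less than `N`. -/
noncomputable def hammingWeight {R : Type*} [CommRing R] {N : ℕ} {l : R} (c : CodeRing N l) : ℕ :=
  (codewordPoly c).support.card

/-- The Hamming distance of a code: the least Hamming weight of a non-zero codeword, and `0` for
the zero code (`sInf ∅ = 0` in `ℕ`). -/
noncomputable def hammingDistance {R : Type*} [CommRing R] {N : ℕ} {l : R}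
    (𝒞 : Ideal (CodeRing N l)) : ℕ :=
  sInf {w | ∃ c ∈ 𝒞, c ≠ 0 ∧ hammingWeight c = w}

/-- The class of the binomial `x ^ n - a` in `R[x] / ⟨x ^ N - l⟩`. -/
noncomputable def binom {R : Type*} [CommRing R] (n : ℕ) (a : R) (N : ℕ) (l : R) : CodeRing N l :=
  AdjoinRoot.mk (X ^ N - C l) (X ^ n - C a)

/-- The class of the constant `c` in `R[x] / ⟨x ^ N - l⟩`. -/
noncomputable def const {R : Type*} [CommRing R] (c : R) (N : ℕ) (l : R) : CodeRing N l :=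
  AdjoinRoot.of (X ^ N - C l) c

/-- The element `(x ^ n - a) ^ ω + γ (x ^ n - a) ^ t G` of `R[x] / ⟨x ^ N - l⟩`. -/
noncomputable def monicGenerator {R : Type*} [CommRing R] (γ : R) (n : ℕ) (a : R) {N : ℕ} {l : R}
    (ω t : ℕ) (G : CodeRing N l) : CodeRing N l :=
  binom n a N l ^ ω + const γ N l * binom n a N l ^ t * G

/-- `G` is a unit of the form `∑_{i=0}^{b-1} a_i(x) (x ^ n - a) ^ i` with all `a_i` in
`𝒫_n(S)`. -/
def IsReducedUnit {R : Type*} [CommRing R] (S : Set R) (n : ℕ) (a : R) {N : ℕ} {l : R} (b : ℕ)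
    (G : CodeRing N l) : Prop :=
  IsUnit G ∧ ∃ A : ℕ → R[X], (∀ i < b, A i ∈ boundedPolys n S) ∧
    G = ∑ i ∈ Finset.range b, AdjoinRoot.mk (X ^ N - C l) (A i) * binom n a N l ^ i

/-- `κ` is the smallest natural number with
`γ (x ^ n - a) ^ κ ∈ ⟨(x ^ n - a) ^ ω + γ (x ^ n - a) ^ t G⟩`. -/
def IsKappa {R : Type*} [CommRing R] (γ : R) (n : ℕ) (a : R) {N : ℕ} {l : R} (ω t : ℕ)
    (G : CodeRing N l) (κ : ℕ) : Prop :=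
  IsLeast {k : ℕ | const γ N l * binom n a N l ^ k ∈ Ideal.span {monicGenerator γ n a ω t G}} κ

/-- Type I: the zero code and the whole ring. -/
def IsTypeI {R : Type*} [CommRing R] {N : ℕ} {l : R} (𝒞 : Ideal (CodeRing N l)) : Prop :=
  𝒞 = ⊥ ∨ 𝒞 = ⊤

/-- Type II: `⟨γ (x ^ n - a) ^ τ⟩` with `0 ≤ τ < q` (below `q = p ^ s`). -/
def IsTypeII {R : Type*} [CommRing R] (γ : R) (q n : ℕ) (a : R) {N : ℕ} {l : R}
    (𝒞 : Ideal (CodeRing N l)) (τ : ℕ) : Prop :=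
  τ < q ∧ 𝒞 = Ideal.span {const γ N l * binom n a N l ^ τ}

/-- Type III: `⟨(x ^ n - a) ^ ω + γ (x ^ n - a) ^ t G⟩` with `0 < ω < q`, and `G` either `0`, or
a reduced unit of length `κ - t` where `0 ≤ t < κ`. -/
def IsTypeIII {R : Type*} [CommRing R] (γ : R) (S : Set R) (q n : ℕ) (a : R) {N : ℕ} {l : R}
    (𝒞 : Ideal (CodeRing N l)) (ω t κ : ℕ) (G : CodeRing N l) : Prop :=
  0 < ω ∧ ω < q ∧ κ ≤ ω ∧ IsKappa γ n a ω t G κ ∧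
    (G = 0 ∨ (t < κ ∧ IsReducedUnit S n a (κ - t) G)) ∧
    𝒞 = Ideal.span {monicGenerator γ n a ω t G}

/-- Type IV: `⟨(x ^ n - a) ^ ω + γ (x ^ n - a) ^ t G, γ (x ^ n - a) ^ μ⟩` with
`0 ≤ μ < κ ≤ ω < q`, and `G` either `0`, or a reduced unit of length `μ - t` where
`0 ≤ t < μ`. -/
def IsTypeIV {R : Type*} [CommRing R] (γ : R) (S : Set R) (q n : ℕ) (a : R) {N : ℕ} {l : R}
    (𝒞 : Ideal (CodeRing N l)) (ω t κ μ : ℕ) (G : CodeRing N l) : Prop :=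
  μ < κ ∧ κ ≤ ω ∧ ω < q ∧ IsKappa γ n a ω t G κ ∧
    (G = 0 ∨ (t < μ ∧ IsReducedUnit S n a (μ - t) G)) ∧
    𝒞 = Ideal.span {monicGenerator γ n a ω t G, const γ N l * binom n a N l ^ μ}

/-- The piecewise formula for an exponent `1 ≤ j ≤ p ^ s - 1`. The ranges are pairwise disjoint
and cover all these `j`; for a prime `p` and `s ≥ 1` no subtraction below is truncated. -/
def PiecewiseDistance (p s j d : ℕ) : Prop :=
  (∃ ℓ : ℕ, ℓ ≤ p - 2 ∧ ℓ * p ^ (s - 1) + 1 ≤ j ∧ j ≤ (ℓ + 1) * p ^ (s - 1) ∧ d = ℓ + 2) ∨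
  (∃ i k : ℕ, 1 ≤ i ∧ i ≤ p - 1 ∧ 1 ≤ k ∧ k ≤ s - 1 ∧
    p ^ s - p ^ (s - k) + (i - 1) * p ^ (s - k - 1) + 1 ≤ j ∧
    j ≤ p ^ s - p ^ (s - k) + i * p ^ (s - k - 1) ∧ d = (i + 1) * p ^ k)

end ConstacyclicCode

/-! Let `q = p ^ s` and let a bar denote reduction modulo `γ`. Because `γ² = 0` and `γ r = 0`
exactly when `r̄ = 0`, the word `γ z` has the weight of `z̄`, while reduction never increases
weight. So a code has the distance of its torsion code `{z̄ : γ z ∈ 𝒞}`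
(`hammingDistance_eq_of_torsion`). By Hensel lifting `f̄` is irreducible, and the modulus reduces to
`f̄ ^ q`; the torsion code is therefore `⟨f̄ ^ j⟩`, with `j = τ, κ, μ` for Types II, III, IV. That
`κ ≥ 1` rests on `f ^ q ∈ γ f 𝒦`, a consequence of `α = α₀ ^ q`.

Over the residue field the distance of `⟨f̄ ^ j⟩` is found by induction on `s`
(`isLeast_weight_binomial_pow`). Passing from `s` to `s + 1`, put `M = n p ^ s`, so that `f̄ ^ (p ^
s) = X ^ M - A`. Splitting exponents by residue modulo `M` turns multiplication by `X ^ M - A` into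
multiplication by `X - A` on slices of degree below `p`, where `l` factors force weight at least `l
+ 1`. For `j ≤ (p - 1) p ^ s` a power of `X ^ M - A` is optimal; beyond that, the factor `(X ^ M -
A) ^ (p - 1)` multiplies by `p` the distance for `j - (p - 1) p ^ s` at length `M`.

For the classification, take the least `ω` with some `f ^ ω + γ w ∈ 𝒞` and the least `μ` with `γ f ^
μ ∈ 𝒞`. These two elements generate `𝒞` when `0 < ω < q`, and `w` matters only modulo `γ` and `f ^
μ`, so its `f`-adic digits may be taken in the Teichmüller set. -/

namespace ConstacyclicCode

/-! ### Minimum weights of multiples of `(X ^ n - a) ^ j` over a field of characteristic `p`. -/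

section Weight

variable {F : Type*} [Field F]

/-- The polynomial whose coefficients are those of `g` at the exponents `i + r * M`. -/
noncomputable def slice (M i : ℕ) (g : F[X]) : F[X] :=
  ∑ r ∈ Finset.range (g.natDegree + 1), monomial r (g.coeff (i + r * M))

theorem coeff_slice {M : ℕ} (hM : 0 < M) (i : ℕ) (g : F[X]) (r : ℕ) :
    (slice M i g).coeff r = g.coeff (i + r * M) := by
  simp only [slice, finsetSum_coeff, coeff_monomial, Finset.sum_ite_eq', Finset.mem_range]
  split_ifs with h
  · rfl
  · symm
    apply coeff_eq_zero_of_natDegree_lt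
    have := Nat.le_mul_of_pos_right r hM
    omega

theorem slice_mul {M i : ℕ} (hi : i < M) (A : F) (h : F[X]) :
    slice M i ((X ^ M - C A) * h) = (X - C A) * slice M i h := by
  have hM : 0 < M := by omega
  ext r
  rw [coeff_slice hM, sub_mul, sub_mul, coeff_sub, coeff_sub, coeff_C_mul, coeff_C_mul,
    coeff_slice hM, coeff_X_pow_mul']
  congr 1
  cases r with
  | zero => simp [hi]
  | succ r =>
    rw [if_pos (by nlinarith), coeff_X_mul, coeff_slice hM]
    congr 1
    have : (r + 1) * M = r * M + M := by ring
    omega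

theorem slice_pow_mul {M i : ℕ} (hi : i < M) (A : F) (l : ℕ) (h : F[X]) :
    slice M i ((X ^ M - C A) ^ l * h) = (X - C A) ^ l * slice M i h := by
  induction l with
  | zero => simp
  | succ l ih => rw [pow_succ', mul_assoc, slice_mul hi, ih, pow_succ', mul_assoc]

theorem exists_slice_ne_zero {M : ℕ} (hM : 0 < M) {g : F[X]} (hg : g ≠ 0) :
    ∃ i < M, slice M i g ≠ 0 := by
  obtain ⟨k, hk⟩ : ∃ k, g.coeff k ≠ 0 := by
    by_contra! h
    exact hg (ext (by simpa using h))
  refine ⟨k % M, Nat.mod_lt _ hM, fun h => hk ?_⟩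
  have := coeff_slice hM (k % M) g (k / M)
  rw [h, coeff_zero, mul_comm, Nat.mod_add_div] at this
  exact this.symm

/-- Distinct slices occupy distinct residue classes of exponents modulo `M`, so their weights add up
inside `g`. -/
theorem sum_card_support_slice_le {M : ℕ} (hM : 0 < M) (g : F[X]) :
    ∑ i ∈ Finset.range M, (slice M i g).support.card ≤ g.support.card := by
  rw [← Finset.card_sigma]
  refine Finset.card_le_card_of_injOn (fun x => x.1 + x.2 * M) ?_ ?_
  · rintro ⟨i, r⟩ h
    simp only [Finset.coe_sigma, Set.mem_sigma_iff, Finset.mem_coe, mem_support_iff,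
      coeff_slice hM] at h
    simpa using h.2
  · rintro ⟨i, r⟩ h ⟨j, t⟩ h' e
    simp only [Finset.coe_sigma, Set.mem_sigma_iff, Finset.mem_coe, Finset.mem_range] at h h' e
    have h1 : i = j := by
      have := congrArg (· % M) e
      simpa [Nat.mod_eq_of_lt h.1, Nat.mod_eq_of_lt h'.1] using this
    subst h1
    have h2 : r = t := by
      have : r * M = t * M := by omega
      exact Nat.eq_of_mul_eq_mul_right hM this
    subst h2
    rfl

/-- Induction on `l`: the operator `X σ' - k σ` with `k = deg σ` removes exactly the leading term
and costs at most one factor `X - A`. The bound on the degree makes the exponents distinct in `F`.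
-/
theorem card_support_gt_of_pow_dvd (p : ℕ) [CharP F p] {A : F} (hA : A ≠ 0) (l : ℕ) :
    ∀ σ : F[X], σ ≠ 0 → σ.natDegree < p → (X - C A) ^ l ∣ σ → l + 1 ≤ σ.support.card := by
  induction l with
  | zero =>
    intro σ h _ _
    simpa [Nat.one_le_iff_ne_zero] using h
  | succ l ih =>
    intro σ h0 hdeg hdvd
    set k := σ.natDegree with hk
    set τ : F[X] := X * derivative σ - C (k : F) * σ with hτ
    have hcoeff : ∀ r, τ.coeff r = ((r : F) - k) * σ.coeff r := by
      intro r
      rw [hτ, coeff_sub, coeff_C_mul]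
      cases r with
      | zero => simp
      | succ r => rw [coeff_X_mul, coeff_derivative]; push_cast; ring
    have hsupp : τ.support = σ.support.erase k := by
      ext r
      simp only [mem_support_iff, hcoeff, Finset.mem_erase, mul_ne_zero_iff]
      refine and_congr_left fun hr => ?_
      have hr' : r ≤ k := le_natDegree_of_ne_zero hr
      rw [sub_ne_zero]
      constructor
      · rintro h rfl
        exact h rfl
      · intro h h'
        exact h (CharP.natCast_injOn_Iio F p (by simp; omega) (by simpa using hdeg) h')
    have hkmem : k ∈ σ.support := by simpa [hk] using h0
    have hcard : τ.support.card + 1 = σ.support.card := by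
      rw [hsupp, Finset.card_erase_add_one hkmem]
    -- Otherwise `σ` is a monomial, which cannot vanish at `A ≠ 0`.
    have hτ0 : τ ≠ 0 := by
      intro h
      rw [h, support_zero] at hsupp
      have hmono : σ = monomial k (σ.coeff k) := by
        ext r
        rw [coeff_monomial]
        split_ifs with hr
        · rw [hr]
        · by_contra hne
          have : r ∈ σ.support.erase k := Finset.mem_erase.2 ⟨Ne.symm hr, mem_support_iff.2 hne⟩
          rw [← hsupp] at this
          simp at this
      have hroot : σ.eval A = 0 :=
        eval_eq_zero_of_dvd_of_eval_eq_zero ((dvd_pow_self _ (Nat.succ_ne_zero l)).trans hdvd)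
          (by simp)
      rw [hmono, eval_monomial] at hroot
      exact (mul_ne_zero (mem_support_iff.1 hkmem) (pow_ne_zero _ hA)) hroot
    have hτd : τ.natDegree < p := by
      refine lt_of_le_of_lt ?_ hdeg
      rw [natDegree_le_iff_coeff_eq_zero]
      intro r hr
      rw [hcoeff, coeff_eq_zero_of_natDegree_lt hr, mul_zero]
    have hτdvd : (X - C A) ^ l ∣ τ := by
      refine dvd_sub (Dvd.dvd.mul_left ?_ _) (Dvd.dvd.mul_left ((pow_dvd_pow _ l.le_succ).trans hdvd) _)
      simpa using pow_sub_one_dvd_derivative_of_pow_dvd hdvd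
    have := ih τ hτ0 hτd hτdvd
    omega

theorem natDegree_slice_lt {M p : ℕ} (hM : 0 < M) (hp : 0 < p) {g : F[X]} (hg : g.degree < (p * M : ℕ))
    (i : ℕ) : (slice M i g).natDegree < p := by
  rw [← Nat.le_sub_one_iff_lt hp, natDegree_le_iff_coeff_eq_zero]
  intro r hr
  replace hr : p ≤ r := by omega
  rw [coeff_slice hM]
  refine (degree_lt_iff_coeff_zero _ _).1 hg _ ?_
  have := Nat.mul_le_mul_right M hr
  omega

theorem mul_card_slices_le (p : ℕ) [CharP F p] {M : ℕ} (hM : 0 < M) (hp : 0 < p) {A : F}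
    (hA : A ≠ 0) {g : F[X]} (hg : g.degree < (p * M : ℕ)) {l : ℕ} (hl : (X ^ M - C A) ^ l ∣ g)
    (S : Finset ℕ) (hS : ∀ i ∈ S, i < M ∧ slice M i g ≠ 0) :
    (l + 1) * S.card ≤ g.support.card := by
  refine le_trans ?_ (sum_card_support_slice_le hM g)
  refine le_trans ?_ (Finset.sum_le_sum_of_subset (s := S) fun i hi =>
    Finset.mem_range.2 (hS i hi).1)
  rw [mul_comm, ← smul_eq_mul]
  refine Finset.card_nsmul_le_sum _ _ _ fun i hi => ?_
  refine card_support_gt_of_pow_dvd p hA l _ (hS i hi).2 (natDegree_slice_lt hM hp hg i) ?_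
  obtain ⟨h, rfl⟩ := hl
  rw [slice_pow_mul (hS i hi).1]
  exact dvd_mul_right _ _

theorem eq_X_pow_mul_expand_slice {M i : ℕ} (hi : i < M) {h : F[X]}
    (H : ∀ j < M, j ≠ i → slice M j h = 0) : h = X ^ i * expand F M (slice M i h) := by
  have hM : 0 < M := by omega
  ext k
  rw [coeff_X_pow_mul', coeff_expand hM]
  by_cases hk : k % M = i
  · have hk' : k - i = M * (k / M) := by have := Nat.mod_add_div k M; omega
    rw [if_pos (hk ▸ Nat.mod_le k M), hk', if_pos (dvd_mul_right _ _), Nat.mul_div_cancel_left _ hM,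
      coeff_slice hM, mul_comm, ← hk, Nat.mod_add_div]
  · have h0 : h.coeff k = 0 := by
      have := coeff_slice hM (k % M) h (k / M)
      rw [H _ (Nat.mod_lt _ hM) hk, coeff_zero, mul_comm, Nat.mod_add_div] at this
      exact this.symm
    rw [h0]
    split_ifs with h1 h2
    · exfalso
      obtain ⟨c, hc⟩ := h2
      apply hk
      rw [show k = i + M * c by omega, Nat.add_mul_mod_self_left, Nat.mod_eq_of_lt hi]
    · rfl
    · rfl

/-- Two nonzero slices already give weight `2 (l + 1)`. With only one, `h = X ^ i σ(X ^ M)`; since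
`σ(X ^ M) ≡ σ(A)` modulo `X ^ M - A`, the factor `f` divides the constant `σ(A)`, which must vanish
and supplies one more factor `X - A`. -/
theorem add_two_le_card_support (p : ℕ) [CharP F p] {M : ℕ} (hM : 0 < M) (hp : 0 < p) {A : F}
    (hA : A ≠ 0) {f : F[X]} (hfu : ¬ IsUnit f) (hfX : ∀ i : ℕ, IsCoprime f (X ^ i))
    (hfM : f ∣ X ^ M - C A) {l : ℕ} {h : F[X]} (hh : h ≠ 0) (hfh : f ∣ h)
    (hg : ((X ^ M - C A) ^ l * h : F[X]).degree < (p * M : ℕ)) :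
    l + 2 ≤ ((X ^ M - C A) ^ l * h : F[X]).support.card := by
  have hne : ∀ i < M, slice M i h ≠ 0 → slice M i ((X ^ M - C A) ^ l * h) ≠ 0 := by
    intro i hi h0
    rw [slice_pow_mul hi]
    exact mul_ne_zero (pow_ne_zero _ (X_sub_C_ne_zero A)) h0
  obtain ⟨i, hi, hi0⟩ := exists_slice_ne_zero hM hh
  by_cases hex : ∃ j < M, j ≠ i ∧ slice M j h ≠ 0
  · obtain ⟨j, hj, hji, hj0⟩ := hex
    have := mul_card_slices_le p hM hp hA hg (dvd_mul_right _ _) {j, i} (by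
      intro k hk
      rw [Finset.mem_insert, Finset.mem_singleton] at hk
      rcases hk with rfl | rfl
      · exact ⟨hj, hne _ hj hj0⟩
      · exact ⟨hi, hne _ hi hi0⟩)
    rw [Finset.card_pair hji] at this
    omega
  · push Not at hex
    have heq := eq_X_pow_mul_expand_slice hi hex
    set σ := slice M i h with hσ
    have h1 : f ∣ expand F M σ := by
      rw [heq] at hfh
      exact (hfX i).dvd_of_dvd_mul_left hfh
    have h2 : X ^ M - C A ∣ expand F M σ - C (σ.eval A) := by
      have := map_dvd (expand F M) (X_sub_C_dvd_sub_C_eval (a := A) (p := σ))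
      simpa using this
    have h3 : f ∣ C (σ.eval A) := by
      have := dvd_sub h1 (hfM.trans h2)
      simpa using this
    have h4 : σ.eval A = 0 := by
      by_contra h5
      exact hfu (isUnit_of_dvd_unit h3 (isUnit_C.2 (isUnit_iff_ne_zero.2 h5)))
    have h5 : (X - C A) ^ (l + 1) ∣ slice M i ((X ^ M - C A) ^ l * h) := by
      rw [slice_pow_mul hi, pow_succ]
      exact mul_dvd_mul_left _ (dvd_iff_isRoot.2 h4)
    refine (card_support_gt_of_pow_dvd p hA (l + 1) _ (hne i hi hi0)
      (natDegree_slice_lt hM hp hg i) h5).trans ?_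
    refine le_trans ?_ (sum_card_support_slice_le hM _)
    exact Finset.single_le_sum (f := fun i => (slice M i ((X ^ M - C A) ^ l * h)).support.card)
      (fun _ _ => Nat.zero_le _) (Finset.mem_range.2 hi)

theorem card_support_binomial_pow_le {R : Type*} [CommRing R] (M : ℕ) (A : R) (l : ℕ) :
    ((X ^ M - C A : R[X]) ^ l).support.card ≤ l + 1 := by
  classical
  refine (Finset.card_le_card (t := (Finset.range (l + 1)).image fun i => M * i) ?_).trans
    (Finset.card_image_le.trans (Finset.card_range _).le)
  intro k hk
  rw [mem_support_iff, sub_eq_add_neg, ← C_neg, add_pow, finsetSum_coeff] at hk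
  obtain ⟨i, hi, hi0⟩ := Finset.exists_ne_zero_of_sum_ne_zero hk
  refine Finset.mem_image.2 ⟨i, hi, ?_⟩
  by_contra hne
  apply hi0
  rw [mul_assoc, ← pow_mul, ← C_pow, ← C_eq_natCast, ← C_mul, coeff_mul_C, coeff_X_pow,
    if_neg (Ne.symm hne), zero_mul]

/-- The formula obeys the same recursion as the minimum weight: the first family at `s` becomes the
family `k = 1` at `s + 1` with `i = ℓ + 1`, and family `k` becomes family `k + 1`. -/
theorem PiecewiseDistance.succ {p s j d : ℕ} (hp : 2 ≤ p) (hj : j < p ^ s)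
    (h : PiecewiseDistance p s j d) :
    PiecewiseDistance p (s + 1) ((p - 1) * p ^ s + j) (p * d) := by
  have hs : 1 ≤ s := by
    rcases Nat.eq_zero_or_pos s with rfl | hs
    · rcases h with ⟨l, -, h, -⟩ | ⟨i, k, -, -, h1, h2, -⟩
      · simp at hj
        omega
      · omega
    · exact hs
  have e0 : p ^ (s + 1) = (p - 1) * p ^ s + p ^ s := by
    rw [pow_succ, Nat.sub_mul, mul_comm]
    have := Nat.le_mul_of_pos_left (p ^ s) (show 0 < p by omega)
    omega
  right
  rcases h with ⟨l, h1, h2, h3, rfl⟩ | ⟨i, k, h1, h2, h3, h4, h5, h6, rfl⟩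
  · refine ⟨l + 1, 1, by omega, by omega, le_rfl, by omega, ?_, ?_, by ring⟩
    · rw [show s + 1 - 1 = s by omega, show l + 1 - 1 = l by omega]
      omega
    · rw [show s + 1 - 1 = s by omega]
      omega
  · have hle : p ^ (s - k) ≤ p ^ s := Nat.pow_le_pow_right (by omega) (by omega)
    refine ⟨i, k + 1, h1, h2, by omega, by omega, ?_, ?_, by ring⟩
    · rw [show s + 1 - (k + 1) = s - k by omega]
      omega
    · rw [show s + 1 - (k + 1) = s - k by omega]
      omega

theorem isLeast_weight_binomial_pow (p : ℕ) [Fact p.Prime] [CharP F p] {n : ℕ} (hn : 0 < n) {a : F}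
    (ha : a ≠ 0) (s : ℕ) : ∀ j, 0 < j → j < p ^ s → ∃ d, PiecewiseDistance p s j d ∧
      IsLeast {w | ∃ g : F[X], g ≠ 0 ∧ g.degree < (n * p ^ s : ℕ) ∧ (X ^ n - C a) ^ j ∣ g ∧
        g.support.card = w} d := by
  have hp : p.Prime := Fact.out
  have hp2 := hp.two_le
  set f : F[X] := X ^ n - C a with hf
  have hf0 : f ≠ 0 := X_pow_sub_C_ne_zero hn a
  have hfu : ¬ IsUnit f := by
    intro h
    have := degree_eq_zero_of_isUnit h
    rw [hf, degree_X_pow_sub_C hn] at this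
    exact hn.ne' (by exact_mod_cast this)
  have hfX : ∀ i : ℕ, IsCoprime f (X ^ i) := by
    intro i
    refine IsCoprime.pow_right (R := F[X]) ?_
    refine ⟨-C a⁻¹, C a⁻¹ * X ^ (n - 1), ?_⟩
    have h1 : (X : F[X]) ^ (n - 1) * X = X ^ n := by rw [← pow_succ, Nat.sub_add_cancel hn]
    have h2 : (C a⁻¹ : F[X]) * C a = 1 := by rw [← C_mul, inv_mul_cancel₀ ha, C_1]
    rw [hf]
    linear_combination C a⁻¹ * h1 + h2
  induction s with
  | zero => intro j h1 h2; simp at h2; omega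
  | succ s ih =>
    intro j hj0 hj
    set M := n * p ^ s with hM
    set A := a ^ p ^ s with hA
    have hMpos : 0 < M := by positivity
    have hA0 : A ≠ 0 := pow_ne_zero _ ha
    have hfp : f ^ p ^ s = X ^ M - C A := by
      rw [hf, sub_pow_char_pow, ← pow_mul, ← C_pow]
    have hN : n * p ^ (s + 1) = p * M := by rw [hM, pow_succ]; ring
    have hP : 0 < p ^ s := by positivity
    rw [hN]
    have hdegY : ∀ l, ((X ^ M - C A : F[X]) ^ l).degree = (l * M : ℕ) := by
      intro l
      rw [degree_pow, degree_X_pow_sub_C hMpos]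
      simp
    by_cases hcase : j ≤ (p - 1) * p ^ s
    -- This `l` satisfies `l p ^ s < j ≤ (l + 1) p ^ s`: a multiple of `f ^ j` contains `(X ^ M - A)
    -- ^ l f`, and `(X ^ M - A) ^ (l + 1)` is a multiple of `f ^ j`.
    · obtain ⟨l, hl⟩ : ∃ l, l = (j - 1) / p ^ s := ⟨_, rfl⟩
      have h1 : l * p ^ s + 1 ≤ j := by
        have := Nat.div_mul_le_self (j - 1) (p ^ s)
        rw [← hl] at this
        omega
      have h2 : j ≤ (l + 1) * p ^ s := by
        have := Nat.lt_mul_div_succ (j - 1) hP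
        rw [← hl, mul_comm] at this
        omega
      have h3 : l + 2 ≤ p := by
        have : l * p ^ s < (p - 1) * p ^ s := by omega
        have := lt_of_mul_lt_mul_right this (Nat.zero_le _)
        omega
      refine ⟨l + 2, Or.inl ⟨l, by omega, by simpa using h1, by simpa using h2, rfl⟩, ?_, ?_⟩
      · have hne : (X ^ M - C A : F[X]) ^ (l + 1) ≠ 0 := by
          rw [← hfp]; exact pow_ne_zero _ (pow_ne_zero _ hf0)
        have hdeg : ((X ^ M - C A : F[X]) ^ (l + 1)).degree < (p * M : ℕ) := by
          rw [hdegY]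
          exact_mod_cast Nat.mul_lt_mul_of_pos_right (by omega) hMpos
        refine ⟨(X ^ M - C A) ^ (l + 1), hne, hdeg, ?_, le_antisymm ?_ ?_⟩
        · rw [← hfp, ← pow_mul, mul_comm]
          exact pow_dvd_pow _ h2
        · exact card_support_binomial_pow_le _ _ _
        · have := add_two_le_card_support p hMpos hp.pos hA0 hfu hfX
            (hfp ▸ dvd_pow_self f hP.ne') (l := l) (h := X ^ M - C A) (by
              rw [← hfp]; exact pow_ne_zero _ hf0) (hfp ▸ dvd_pow_self f hP.ne')
          rw [← pow_succ] at this
          exact this hdeg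
      · rintro w ⟨g, hg0, hgdeg, hgd, rfl⟩
        obtain ⟨k, rfl⟩ : ∃ k, g = (X ^ M - C A) ^ l * (f * k) := by
          obtain ⟨k, hk⟩ := (pow_dvd_pow f h1).trans hgd
          refine ⟨k, ?_⟩
          rw [hk, ← hfp, ← pow_mul, pow_succ, mul_comm (p ^ s) l]
          ring
        exact add_two_le_card_support p hMpos hp.pos hA0 hfu hfX
            (hfp ▸ dvd_pow_self f hP.ne') (right_ne_zero_of_mul hg0) (dvd_mul_right _ _) hgdeg
    · push Not at hcase
      have e0 : p ^ (s + 1) = (p - 1) * p ^ s + p ^ s := by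
        rw [pow_succ, Nat.sub_mul, mul_comm]
        have := Nat.le_mul_of_pos_left (p ^ s) hp.pos
        omega
      obtain ⟨j', rfl⟩ := Nat.exists_eq_add_of_lt hcase
      obtain ⟨d, hd, ⟨e, he0, hedeg, hed, hew⟩, hmin⟩ := ih (j' + 1) (by omega) (by omega)
      have hfj : f ^ ((p - 1) * p ^ s + j' + 1) = (X ^ M - C A) ^ (p - 1) * f ^ (j' + 1) := by
        rw [← hfp, ← pow_mul, ← pow_add]
        congr 1
        ring
      have hY0 : (X ^ M - C A : F[X]) ^ (p - 1) ≠ 0 := by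
        rw [← hfp]; exact pow_ne_zero _ (pow_ne_zero _ hf0)
      have hlow : ∀ g : F[X], g ≠ 0 → g.degree < (p * M : ℕ) →
          f ^ ((p - 1) * p ^ s + j' + 1) ∣ g → p * d ≤ g.support.card := by
        rintro g hg0 hgdeg ⟨k, hk⟩
        set e := f ^ (j' + 1) * k with he
        have hge : g = (X ^ M - C A) ^ (p - 1) * e := by rw [hk, hfj, he, mul_assoc]
        have he0 : e ≠ 0 := right_ne_zero_of_mul (hge ▸ hg0)
        have hedeg : e.degree < (M : ℕ) := by
          rw [hge, degree_mul, hdegY, degree_eq_natDegree he0] at hgdeg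
          rw [degree_eq_natDegree he0]
          have h1 : (p - 1) * M + e.natDegree < p * M := by exact_mod_cast hgdeg
          have h2 : p * M = (p - 1) * M + M := by
            rw [Nat.sub_mul]
            have := Nat.le_mul_of_pos_left M hp.pos
            omega
          exact_mod_cast (show e.natDegree < M by omega)
        -- As `deg e < M`, each nonzero coefficient of `e` is the constant term of its own slice,
        -- and each such slice contributes weight at least `p`.
        have h1 := mul_card_slices_le p hMpos hp.pos hA0 hgdeg (hge ▸ dvd_mul_right _ _) e.support
          (by
            intro i hi
            have hiM : i < M := by
              by_contra h
              exact mem_support_iff.1 hi ((degree_lt_iff_coeff_zero _ _).1 hedeg i (by omega))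
            refine ⟨hiM, ?_⟩
            rw [hge, slice_pow_mul hiM]
            refine mul_ne_zero (pow_ne_zero _ (X_sub_C_ne_zero A)) fun h => ?_
            have := coeff_slice hMpos i e 0
            rw [h, coeff_zero, zero_mul, add_zero] at this
            exact mem_support_iff.1 hi this.symm)
        rw [Nat.sub_add_cancel hp.pos] at h1
        exact (Nat.mul_le_mul_left p (hmin ⟨e, he0, hedeg, dvd_mul_right _ _, rfl⟩)).trans h1
      refine ⟨p * d, hd.succ hp2 (by omega), ?_, ?_⟩
      · have hne := mul_ne_zero hY0 he0
        have hdeg : ((X ^ M - C A) ^ (p - 1) * e : F[X]).degree < (p * M : ℕ) := by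
          rw [degree_mul, hdegY, degree_eq_natDegree he0]
          rw [degree_eq_natDegree he0] at hedeg
          have h1 : e.natDegree < M := by exact_mod_cast hedeg
          have h2 : p * M = (p - 1) * M + M := by
            rw [Nat.sub_mul]
            have := Nat.le_mul_of_pos_left M hp.pos
            omega
          exact_mod_cast (show (p - 1) * M + e.natDegree < p * M by omega)
        have hdv : f ^ ((p - 1) * p ^ s + j' + 1) ∣ (X ^ M - C A) ^ (p - 1) * e := by
          rw [hfj]; exact mul_dvd_mul_left _ hed
        refine ⟨_, hne, hdeg, hdv, le_antisymm ?_ (hlow _ hne hdeg hdv)⟩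
        refine (card_support_mul_le).trans ?_
        rw [hew]
        refine Nat.mul_le_mul_right _ ((card_support_binomial_pow_le _ _ _).trans ?_)
        omega
      · rintro w ⟨g, hg0, hgdeg, hgd, rfl⟩
        exact hlow g hg0 hgdeg hgd

end Weight

/-! ### Reduction modulo `γ` and the torsion code. -/

section ChainRing

variable {R : Type*} [CommRing R] [IsLocalRing R] {γ : R}

open IsLocalRing

namespace IsChainRingWith

theorem mul_self (hR : IsChainRingWith R γ 2) : γ * γ = 0 := by
  rw [← sq]
  exact (nilpotencyClass_eq_succ_iff.1 hR.nilpotencyClass_eq).1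

theorem ne_zero (hR : IsChainRingWith R γ 2) : γ ≠ 0 := by
  simpa using (nilpotencyClass_eq_succ_iff.1 hR.nilpotencyClass_eq).2

theorem residue_eq_zero_iff (hR : IsChainRingWith R γ 2) {r : R} :
    residue R r = 0 ↔ ∃ c, r = γ * c := by
  rw [IsLocalRing.residue_eq_zero_iff, hR.maximalIdeal_eq, Ideal.mem_span_singleton]
  rfl

theorem mul_eq_zero_iff (hR : IsChainRingWith R γ 2) {r : R} : γ * r = 0 ↔ residue R r = 0 := by
  constructor
  · intro h
    by_contra h'
    have hu : IsUnit r := by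
      by_contra hu
      exact h' ((IsLocalRing.residue_eq_zero_iff r).2 ((mem_maximalIdeal r).2 hu))
    exact hR.ne_zero ((hu.mul_left_eq_zero).1 h)
  · rw [hR.residue_eq_zero_iff]
    rintro ⟨c, rfl⟩
    rw [← mul_assoc, hR.mul_self, zero_mul]

theorem support_C_mul (hR : IsChainRingWith R γ 2) (g : R[X]) :
    (C γ * g).support = (g.map (residue R)).support := by
  ext i
  simp only [mem_support_iff, coeff_C_mul, coeff_map, ne_eq, hR.mul_eq_zero_iff]

theorem C_mul_eq_zero_iff (hR : IsChainRingWith R γ 2) {g : R[X]} :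
    C γ * g = 0 ↔ g.map (residue R) = 0 := by
  rw [← support_eq_empty, hR.support_C_mul, support_eq_empty]

theorem map_residue_eq_zero_iff (hR : IsChainRingWith R γ 2) {g : R[X]} :
    g.map (residue R) = 0 ↔ ∃ w, g = C γ * w := by
  constructor
  · intro h
    have h1 : C γ ∣ g := by
      rw [C_dvd_iff_dvd_coeff]
      intro i
      have := congrArg (fun q => coeff q i) h
      simp only [coeff_map, coeff_zero] at this
      exact hR.residue_eq_zero_iff.1 this
    exact h1
  · rintro ⟨w, rfl⟩
    rw [Polynomial.map_mul, map_C, hR.residue_eq_zero_iff.2 ⟨1, (mul_one γ).symm⟩, C_0, zero_mul]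

theorem residue_self (hR : IsChainRingWith R γ 2) : residue R γ = 0 :=
  hR.residue_eq_zero_iff.2 ⟨1, (mul_one γ).symm⟩

end IsChainRingWith

/-- Reduction of codewords modulo the maximal ideal. -/
noncomputable def reduction (N : ℕ) (l : R) : CodeRing N l →+* CodeRing N (residue R l) :=
  AdjoinRoot.lift ((AdjoinRoot.of _).comp (residue R)) (AdjoinRoot.root _) (by
    rw [← eval₂_map]
    have := AdjoinRoot.eval₂_root (X ^ N - C (residue R l))
    simpa using this)

theorem reduction_mk {N : ℕ} {l : R} (g : R[X]) :
    reduction N l (AdjoinRoot.mk _ g) = AdjoinRoot.mk _ (g.map (residue R)) := by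
  rw [reduction, AdjoinRoot.lift_mk, ← eval₂_map, ← AdjoinRoot.aeval_eq]
  rfl

theorem reduction_surjective (N : ℕ) (l : R) : Function.Surjective (reduction N l) := by
  intro z
  obtain ⟨g, rfl⟩ := AdjoinRoot.mk_surjective z
  obtain ⟨g', rfl⟩ := map_surjective (residue R) residue_surjective g
  exact ⟨AdjoinRoot.mk _ g', reduction_mk g'⟩

theorem const_eq_mk {S : Type*} [CommRing S] {N : ℕ} {l : S} (c : S) : const c N l = AdjoinRoot.mk _ (C c) := rfl

theorem mk_codewordPoly {S : Type*} [CommRing S] [Nontrivial S] {N : ℕ} (hN : N ≠ 0) {l : S}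
    (z : CodeRing N l) : AdjoinRoot.mk _ (codewordPoly z) = z :=
  ((codewordPoly_eq_iff hN z _).1 rfl).2

theorem degree_codewordPoly {S : Type*} [CommRing S] [Nontrivial S] {N : ℕ} (hN : N ≠ 0) {l : S}
    (z : CodeRing N l) : (codewordPoly z).degree < N :=
  ((codewordPoly_eq_iff hN z _).1 rfl).1

theorem codewordPoly_const_mul {N : ℕ} (hN : N ≠ 0) {l : R} (c : R) (z : CodeRing N l) :
    codewordPoly (const c N l * z) = C c * codewordPoly z := by
  rw [codewordPoly_eq_iff hN, map_mul, mk_codewordPoly hN]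
  refine ⟨lt_of_le_of_lt ?_ (degree_codewordPoly hN z), rfl⟩
  rw [C_mul']
  exact degree_smul_le _ _

theorem codewordPoly_reduction {N : ℕ} (hN : N ≠ 0) {l : R} (z : CodeRing N l) :
    codewordPoly (reduction N l z) = (codewordPoly z).map (residue R) := by
  rw [codewordPoly_eq_iff hN, ← reduction_mk, mk_codewordPoly hN]
  exact ⟨degree_map_le.trans_lt (degree_codewordPoly hN z), rfl⟩

theorem codewordPoly_eq_zero_iff {S : Type*} [CommRing S] [Nontrivial S] {N : ℕ} (hN : N ≠ 0)
    {l : S} {z : CodeRing N l} : codewordPoly z = 0 ↔ z = 0 := by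
  rw [codewordPoly_eq_iff hN, map_zero, degree_zero, eq_comm (a := (0 : CodeRing N l))]
  exact and_iff_right (WithBot.bot_lt_coe N)

theorem hammingWeight_const_mul (hR : IsChainRingWith R γ 2) {N : ℕ} (hN : N ≠ 0) {l : R}
    (z : CodeRing N l) : hammingWeight (const γ N l * z) = hammingWeight (reduction N l z) := by
  rw [hammingWeight, hammingWeight, codewordPoly_const_mul hN, codewordPoly_reduction hN,
    hR.support_C_mul]

theorem hammingWeight_reduction_le {N : ℕ} (hN : N ≠ 0) {l : R} (z : CodeRing N l) :
    hammingWeight (reduction N l z) ≤ hammingWeight z := by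
  rw [hammingWeight, hammingWeight, codewordPoly_reduction hN]
  exact Finset.card_le_card (support_map_subset _ _)

theorem const_mul_eq_zero_iff (hR : IsChainRingWith R γ 2) {N : ℕ} (hN : N ≠ 0) {l : R}
    {z : CodeRing N l} : const γ N l * z = 0 ↔ reduction N l z = 0 := by
  rw [← codewordPoly_eq_zero_iff hN, codewordPoly_const_mul hN, hR.C_mul_eq_zero_iff,
    ← codewordPoly_reduction hN, codewordPoly_eq_zero_iff hN]

theorem reduction_eq_zero_iff (hR : IsChainRingWith R γ 2) {N : ℕ} (hN : N ≠ 0) {l : R}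
    {z : CodeRing N l} : reduction N l z = 0 ↔ ∃ w, z = const γ N l * w := by
  constructor
  · intro h
    rw [← codewordPoly_eq_zero_iff hN, codewordPoly_reduction hN, hR.map_residue_eq_zero_iff] at h
    obtain ⟨w, hw⟩ := h
    refine ⟨AdjoinRoot.mk _ w, ?_⟩
    rw [← mk_codewordPoly hN z, hw, map_mul, const_eq_mk]
  · rintro ⟨w, rfl⟩
    rw [map_mul, const_eq_mk, reduction_mk, map_C, hR.residue_self, C_0, map_zero, zero_mul]

theorem reduction_const_mul (hR : IsChainRingWith R γ 2) {N : ℕ} (hN : N ≠ 0) {l : R}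
    (z : CodeRing N l) : reduction N l (const γ N l * z) = 0 :=
  (reduction_eq_zero_iff hR hN).2 ⟨z, rfl⟩

theorem const_mul_const_mul (hR : IsChainRingWith R γ 2) {N : ℕ} (hN : N ≠ 0) {l : R}
    (z : CodeRing N l) : const γ N l * (const γ N l * z) = 0 :=
  (const_mul_eq_zero_iff hR hN).2 (reduction_const_mul hR hN z)

/-- Domination in both directions also makes the sets empty together, which covers the default value
`sInf ∅ = 0`. -/
theorem sInf_eq_of_forall_exists_le {S T : Set ℕ} (h1 : ∀ a ∈ S, ∃ b ∈ T, b ≤ a)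
    (h2 : ∀ a ∈ T, ∃ b ∈ S, b ≤ a) : sInf S = sInf T := by
  rcases S.eq_empty_or_nonempty with rfl | hS
  · have : T = ∅ := by
      by_contra h
      obtain ⟨a, ha⟩ := Set.nonempty_iff_ne_empty.2 h
      obtain ⟨b, hb, -⟩ := h2 a ha
      exact hb
    rw [this]
  · have hT : T.Nonempty := by
      obtain ⟨a, ha⟩ := hS
      obtain ⟨b, hb, -⟩ := h1 a ha
      exact ⟨b, hb⟩
    apply le_antisymm
    · obtain ⟨b, hb, hle⟩ := h2 _ (Nat.sInf_mem hT)
      exact (Nat.sInf_le hb).trans hle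
    · obtain ⟨b, hb, hle⟩ := h1 _ (Nat.sInf_mem hS)
      exact (Nat.sInf_le hb).trans hle

/-- A code has the Hamming distance of its torsion code. -/
theorem hammingDistance_eq_of_torsion (hR : IsChainRingWith R γ 2) {N : ℕ} (hN : N ≠ 0) {l : R}
    {𝒞 : Ideal (CodeRing N l)} {𝒟 : Ideal (CodeRing N (residue R l))}
    (H : ∀ z, const γ N l * z ∈ 𝒞 ↔ reduction N l z ∈ 𝒟) :
    hammingDistance 𝒞 = hammingDistance 𝒟 := by
  apply sInf_eq_of_forall_exists_le
  · rintro w ⟨c, hc, hc0, rfl⟩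
    -- A codeword in the kernel is some `γ z`, of the same weight as `z̄`; any other codeword
    -- reduces into the torsion code because `γ c ∈ 𝒞`.
    by_cases h : reduction N l c = 0
    · obtain ⟨z, rfl⟩ := (reduction_eq_zero_iff hR hN).1 h
      refine ⟨_, ⟨reduction N l z, (H z).1 hc, ?_, rfl⟩, (hammingWeight_const_mul hR hN z).ge⟩
      exact fun h => hc0 ((const_mul_eq_zero_iff hR hN).2 h)
    · exact ⟨_, ⟨reduction N l c, (H c).1 (𝒞.mul_mem_left _ hc), h, rfl⟩,
        hammingWeight_reduction_le hN c⟩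
  · rintro w ⟨c, hc, hc0, rfl⟩
    obtain ⟨z, rfl⟩ := reduction_surjective N l c
    exact ⟨_, ⟨const γ N l * z, (H z).2 hc, fun h => hc0 ((const_mul_eq_zero_iff hR hN).1 h), rfl⟩,
      (hammingWeight_const_mul hR hN z).le⟩

end ChainRing

/-! ### Distances of the trivial codes and of `⟨(x ^ n - a) ^ j⟩` over a field. -/

theorem hammingDistance_bot {S : Type*} [CommRing S] {N : ℕ} {l : S} :
    hammingDistance (⊥ : Ideal (CodeRing N l)) = 0 := by
  have : {w | ∃ c ∈ (⊥ : Ideal (CodeRing N l)), c ≠ 0 ∧ hammingWeight c = w} = ∅ := by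
    refine Set.eq_empty_iff_forall_notMem.2 ?_
    rintro w ⟨c, hc, hc0, -⟩
    exact hc0 hc
  rw [hammingDistance, this, Nat.sInf_empty]

theorem hammingDistance_top {S : Type*} [CommRing S] [Nontrivial S] {N : ℕ} (hN : N ≠ 0) {l : S} :
    hammingDistance (⊤ : Ideal (CodeRing N l)) = 1 := by
  have hone : codewordPoly (1 : CodeRing N l) = 1 := by
    rw [codewordPoly_eq_iff hN, map_one]
    refine ⟨?_, rfl⟩
    rw [degree_one]
    exact_mod_cast Nat.pos_of_ne_zero hN
  refine IsLeast.csInf_eq ⟨⟨1, trivial, ?_, ?_⟩, ?_⟩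
  · rw [ne_eq, ← codewordPoly_eq_zero_iff hN, hone]
    exact one_ne_zero
  · rw [hammingWeight, hone, ← C_1, support_C one_ne_zero, Finset.card_singleton]
  · rintro w ⟨c, -, hc, rfl⟩
    rw [hammingWeight, Nat.one_le_iff_ne_zero, ne_eq, Finset.card_eq_zero, support_eq_empty,
      codewordPoly_eq_zero_iff hN]
    exact hc

theorem mk_mem_span_binom_pow_iff {S : Type*} [CommRing S] {N n : ℕ} {l a : S} {j : ℕ}
    (hj : (X ^ n - C a) ^ j ∣ (X ^ N - C l : S[X])) (g : S[X]) :
    AdjoinRoot.mk (X ^ N - C l) g ∈ Ideal.span {binom n a N l ^ j} ↔ (X ^ n - C a) ^ j ∣ g := by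
  rw [Ideal.mem_span_singleton, binom, ← map_pow]
  constructor
  · rintro ⟨z, hz⟩
    obtain ⟨y, rfl⟩ := AdjoinRoot.mk_surjective z
    rw [← map_mul, AdjoinRoot.mk_eq_mk] at hz
    have := (hj.trans hz).add (dvd_mul_right ((X ^ n - C a) ^ j) y)
    simpa using this
  · exact fun h => map_dvd _ h

theorem hammingDistance_span_binom_pow {F : Type*} [Field F] (p : ℕ) [Fact p.Prime] [CharP F p]
    {n : ℕ} (hn : 0 < n) {a : F} (ha : a ≠ 0) {s j : ℕ} (hj0 : 0 < j) (hj : j < p ^ s) :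
    PiecewiseDistance p s j
      (hammingDistance (Ideal.span {binom n a (n * p ^ s) (a ^ p ^ s) ^ j})) := by
  have hp : p.Prime := Fact.out
  have hN : n * p ^ s ≠ 0 := (Nat.mul_pos hn (pow_pos hp.pos s)).ne'
  have hfp : (X ^ n - C a : F[X]) ^ p ^ s = X ^ (n * p ^ s) - C (a ^ p ^ s) := by
    rw [sub_pow_char_pow, ← pow_mul, ← C_pow]
  have hdvd : (X ^ n - C a : F[X]) ^ j ∣ X ^ (n * p ^ s) - C (a ^ p ^ s) :=
    hfp ▸ pow_dvd_pow _ hj.le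
  obtain ⟨d, hd, hleast⟩ := isLeast_weight_binomial_pow p hn ha s j hj0 hj
  have : hammingDistance (Ideal.span {binom n a (n * p ^ s) (a ^ p ^ s) ^ j}) = d := by
    rw [hammingDistance, ← hleast.csInf_eq]
    congr 1
    ext w
    constructor
    · rintro ⟨c, hc, hc0, rfl⟩
      refine ⟨codewordPoly c, (codewordPoly_eq_zero_iff hN).not.2 hc0, degree_codewordPoly hN c,
        ?_, rfl⟩
      rwa [← mk_mem_span_binom_pow_iff hdvd, mk_codewordPoly hN]
    · rintro ⟨g, hg0, hg, hgd, rfl⟩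
      have h := (codewordPoly_eq_iff hN (AdjoinRoot.mk (X ^ (n * p ^ s) - C (a ^ p ^ s)) g) g).2
        ⟨hg, rfl⟩
      refine ⟨AdjoinRoot.mk _ g, (mk_mem_span_binom_pow_iff hdvd g).2 hgd, ?_, ?_⟩
      · rwa [ne_eq, ← codewordPoly_eq_zero_iff hN, h]
      · rw [hammingWeight, h]
  rwa [this]

/-! ### Structure of the code ring modulo `γ`, and torsion codes of the generators. -/

open IsLocalRing

/-- The binomial `x ^ n - a` is irreducible modulo `γ`, and modulo `γ` its `q`-th power is the
modulus `x ^ (n * q) - l`. -/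
structure IsPrimaryModulus {R : Type*} [CommRing R] [IsLocalRing R] (γ : R) (n q : ℕ)
    (a l : R) : Prop where
  chain : IsChainRingWith R γ 2
  n_pos : 0 < n
  q_pos : 0 < q
  irreducible : Irreducible (X ^ n - C (residue R a))
  pow_eq : (X ^ n - C (residue R a)) ^ q = X ^ (n * q) - C (residue R l)
  binom_pow : ∃ y, binom n a (n * q) l ^ q = const γ (n * q) l * (binom n a (n * q) l * y)

namespace IsPrimaryModulus

variable {R : Type*} [CommRing R] [IsLocalRing R] {γ a l : R} {n q : ℕ}

theorem length_ne_zero (h : IsPrimaryModulus γ n q a l) : n * q ≠ 0 :=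
  (Nat.mul_pos h.n_pos h.q_pos).ne'

theorem reduction_binom {N : ℕ} :
    reduction N l (binom n a N l) = binom n (residue R a) N (residue R l) := by
  rw [binom, binom, reduction_mk, Polynomial.map_sub, Polynomial.map_pow, map_X, map_C]

theorem isUnit_of_reduction (h : IsPrimaryModulus γ n q a l) {z : CodeRing (n * q) l}
    (hz : IsUnit (reduction (n * q) l z)) : IsUnit z := by
  obtain ⟨y, hy⟩ := hz.exists_right_inv
  obtain ⟨y, rfl⟩ := reduction_surjective _ _ y
  obtain ⟨w, hw⟩ := (reduction_eq_zero_iff h.chain h.length_ne_zero (z := z * y - 1)).1 (by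
    rw [map_sub, map_mul, hy, map_one, sub_self])
  refine IsUnit.of_mul_eq_one (y * (1 - const γ _ _ * w)) ?_
  have := const_mul_const_mul h.chain h.length_ne_zero w
  linear_combination (1 - const γ _ _ * w) * hw - w * this

theorem isUnit_mk (h : IsPrimaryModulus γ n q a l) {g : R[X]}
    (hg : ¬ X ^ n - C (residue R a) ∣ g.map (residue R)) :
    IsUnit (AdjoinRoot.mk (X ^ (n * q) - C l) g) := by
  apply h.isUnit_of_reduction
  rw [reduction_mk]
  obtain ⟨u, v, huv⟩ : IsCoprime (g.map (residue R)) (X ^ (n * q) - C (residue R l)) := by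
    rw [← h.pow_eq]
    exact (((h.irreducible.coprime_iff_not_dvd).2 hg).symm).pow_right
  refine IsUnit.of_mul_eq_one (AdjoinRoot.mk _ u) ?_
  rw [← map_mul, ← sub_eq_zero, ← map_one (AdjoinRoot.mk _), ← map_sub, AdjoinRoot.mk_eq_zero]
  exact ⟨-v, by linear_combination huv⟩

/-- Modulo `γ` the ring is `F[x] / f̄ ^ q` with `f̄` irreducible, where every element is a power of
`f̄` times a unit. The zero class is covered by `v = q`. -/
theorem exists_eq_pow_mul_unit (h : IsPrimaryModulus γ n q a l) (z : CodeRing (n * q) l) :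
    ∃ v ≤ q, ∃ u w, IsUnit u ∧ z = binom n a (n * q) l ^ v * u + const γ (n * q) l * w := by
  obtain ⟨g, rfl⟩ := AdjoinRoot.mk_surjective z
  suffices H : ∃ v ≤ q, ∃ u, IsUnit u ∧ reduction (n * q) l (AdjoinRoot.mk _ g) =
      reduction (n * q) l (binom n a (n * q) l ^ v * u) by
    obtain ⟨v, hv, u, hu, H⟩ := H
    obtain ⟨w, hw⟩ := (reduction_eq_zero_iff h.chain h.length_ne_zero).1
      ((map_sub _ _ _).trans (sub_eq_zero.2 H))
    exact ⟨v, hv, u, w, hu, by linear_combination hw⟩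
  by_cases hq : (X ^ n - C (residue R a)) ^ q ∣ g.map (residue R)
  · refine ⟨q, le_rfl, 1, isUnit_one, ?_⟩
    obtain ⟨y, hy⟩ := h.binom_pow
    rw [mul_one, hy, reduction_const_mul h.chain h.length_ne_zero, reduction_mk,
      AdjoinRoot.mk_eq_zero, ← h.pow_eq]
    exact hq
  · have hg0 : g.map (residue R) ≠ 0 := by
      intro h0
      exact hq (h0 ▸ dvd_zero _)
    obtain ⟨v, c, hc, hgc⟩ := WfDvdMonoid.max_power_factor hg0 h.irreducible
    obtain ⟨u, rfl⟩ := map_surjective (residue R) residue_surjective c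
    refine ⟨v, ?_, AdjoinRoot.mk _ u, h.isUnit_mk hc, ?_⟩
    · by_contra! hv
      exact hq (hgc ▸ (pow_dvd_pow _ hv.le).mul_right _)
    · rw [map_mul, map_pow, reduction_binom, reduction_mk, reduction_mk, hgc, map_mul, map_pow]
      rfl

theorem le_of_binom_pow_eq (h : IsPrimaryModulus γ n q a l) {k : ℕ} {w : CodeRing (n * q) l}
    (hk : binom n a (n * q) l ^ k = const γ (n * q) l * w) : q ≤ k := by
  have h1 := congrArg (reduction (n * q) l) hk
  rw [reduction_const_mul h.chain h.length_ne_zero, map_pow, reduction_binom, binom, ← map_pow,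
    AdjoinRoot.mk_eq_zero, ← h.pow_eq] at h1
  exact (pow_dvd_pow_iff h.irreducible.ne_zero h.irreducible.not_isUnit).1 h1

theorem reduction_mem_span_iff (h : IsPrimaryModulus γ n q a l) {j : ℕ} {z : CodeRing (n * q) l} :
    reduction (n * q) l z ∈ Ideal.span {binom n (residue R a) (n * q) (residue R l) ^ j} ↔
      ∃ y w, z = binom n a (n * q) l ^ j * y + const γ (n * q) l * w := by
  rw [Ideal.mem_span_singleton]
  constructor
  · rintro ⟨y, hy⟩
    obtain ⟨y, rfl⟩ := reduction_surjective _ _ y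
    obtain ⟨w, hw⟩ := (reduction_eq_zero_iff h.chain h.length_ne_zero
      (z := z - binom n a (n * q) l ^ j * y)).1 (by
        rw [map_sub, map_mul, map_pow, reduction_binom, hy, sub_self])
    exact ⟨y, w, by linear_combination hw⟩
  · rintro ⟨y, w, rfl⟩
    rw [map_add, reduction_const_mul h.chain h.length_ne_zero, add_zero, map_mul, map_pow,
      reduction_binom]
    exact dvd_mul_right _ _

theorem const_mul_mem_of_isLeast (h : IsPrimaryModulus γ n q a l) {𝒞 : Ideal (CodeRing (n * q) l)}
    {j : ℕ} (hj : IsLeast {k | const γ (n * q) l * binom n a (n * q) l ^ k ∈ 𝒞} j)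
    (z : CodeRing (n * q) l) :
    const γ (n * q) l * z ∈ 𝒞 ↔
      reduction (n * q) l z ∈ Ideal.span {binom n (residue R a) (n * q) (residue R l) ^ j} := by
  have hγγ := const_mul_const_mul h.chain h.length_ne_zero (l := l)
  constructor
  · obtain ⟨v, hv, u, w, hu, rfl⟩ := h.exists_eq_pow_mul_unit z
    intro hz
    obtain ⟨u', hu'⟩ := hu.exists_right_inv
    have h1 : const γ (n * q) l * binom n a (n * q) l ^ v ∈ 𝒞 := by
      have := 𝒞.mul_mem_right u' hz
      convert this using 1
      linear_combination (-const γ (n * q) l * binom n a (n * q) l ^ v) * hu' - u' * hγγ w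
    have h2 : j ≤ v := hj.2 h1
    refine h.reduction_mem_span_iff.2 ⟨binom n a (n * q) l ^ (v - j) * u, w, ?_⟩
    rw [← mul_assoc, ← pow_add, Nat.add_sub_cancel' h2]
  · intro hz
    obtain ⟨y, w, rfl⟩ := h.reduction_mem_span_iff.1 hz
    have := 𝒞.mul_mem_right y hj.1
    convert this using 1
    linear_combination hγγ w

theorem const_mul_mem_span_const_mul (h : IsPrimaryModulus γ n q a l) (τ : ℕ)
    (z : CodeRing (n * q) l) :
    const γ (n * q) l * z ∈ Ideal.span {const γ (n * q) l * binom n a (n * q) l ^ τ} ↔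
      reduction (n * q) l z ∈ Ideal.span {binom n (residue R a) (n * q) (residue R l) ^ τ} := by
  rw [h.reduction_mem_span_iff, Ideal.mem_span_singleton]
  constructor
  · rintro ⟨y, hy⟩
    have : const γ (n * q) l * (z - binom n a (n * q) l ^ τ * y) = 0 := by
      linear_combination hy
    rw [const_mul_eq_zero_iff h.chain h.length_ne_zero,
      reduction_eq_zero_iff h.chain h.length_ne_zero] at this
    obtain ⟨w, hw⟩ := this
    exact ⟨y, w, by linear_combination hw⟩
  · rintro ⟨y, w, rfl⟩
    refine ⟨y, ?_⟩
    linear_combination const_mul_const_mul h.chain h.length_ne_zero w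

/-- Subtracting the multiple of `γ f ^ μ` leaves an element of `⟨g⟩`, whose torsion `⟨f̄ ^ κ⟩` lies
in `⟨f̄ ^ μ⟩`. -/
theorem const_mul_mem_span_pair (h : IsPrimaryModulus γ n q a l) {g : CodeRing (n * q) l}
    {κ μ : ℕ} (hμ : μ ≤ κ)
    (hκ : IsLeast {k | const γ (n * q) l * binom n a (n * q) l ^ k ∈ Ideal.span {g}} κ)
    (z : CodeRing (n * q) l) :
    const γ (n * q) l * z ∈ Ideal.span {g, const γ (n * q) l * binom n a (n * q) l ^ μ} ↔
      reduction (n * q) l z ∈ Ideal.span {binom n (residue R a) (n * q) (residue R l) ^ μ} := by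
  rw [h.reduction_mem_span_iff, Ideal.mem_span_pair]
  constructor
  · rintro ⟨x, y, hxy⟩
    have h1 : const γ (n * q) l * (z - binom n a (n * q) l ^ μ * y) ∈ Ideal.span {g} :=
      Ideal.mem_span_singleton.2 ⟨x, by linear_combination -hxy⟩
    rw [h.const_mul_mem_of_isLeast hκ, h.reduction_mem_span_iff] at h1
    obtain ⟨y', w, hw⟩ := h1
    refine ⟨y + binom n a (n * q) l ^ (κ - μ) * y', w, ?_⟩
    have : binom n a (n * q) l ^ κ = binom n a (n * q) l ^ μ * binom n a (n * q) l ^ (κ - μ) := by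
      rw [← pow_add, Nat.add_sub_cancel' hμ]
    rw [this] at hw
    linear_combination hw
  · rintro ⟨y, w, rfl⟩
    refine ⟨0, y, ?_⟩
    linear_combination -const_mul_const_mul h.chain h.length_ne_zero w

theorem isNilpotent_binom (h : IsPrimaryModulus γ n q a l) :
    IsNilpotent (binom n a (n * q) l) := by
  obtain ⟨y, hy⟩ := h.binom_pow
  refine ⟨q * 2, ?_⟩
  rw [pow_mul, hy]
  linear_combination (binom n a (n * q) l * y) ^ 2 *
    const_mul_const_mul h.chain h.length_ne_zero (1 : CodeRing (n * q) l)

theorem const_ne_zero (h : IsPrimaryModulus γ n q a l) : const γ (n * q) l ≠ 0 := by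
  intro h0
  have h1 := codewordPoly_const_mul h.length_ne_zero γ (1 : CodeRing (n * q) l)
  rw [h0, zero_mul] at h1
  have h2 : codewordPoly (1 : CodeRing (n * q) l) = 1 := by
    rw [codewordPoly_eq_iff h.length_ne_zero, map_one, degree_one]
    exact ⟨by exact_mod_cast Nat.pos_of_ne_zero h.length_ne_zero, rfl⟩
  rw [(codewordPoly_eq_zero_iff h.length_ne_zero).2 rfl, h2, mul_one] at h1
  exact h.chain.ne_zero (C_eq_zero.1 h1.symm)

/-- A generator with positive leading exponent `ω < q` does not divide `γ`. -/
theorem const_notMem_span_monicGenerator (h : IsPrimaryModulus γ n q a l) {ω t : ℕ} (hω0 : 0 < ω)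
    (hω : ω < q) (G : CodeRing (n * q) l) :
    const γ (n * q) l ∉ Ideal.span {monicGenerator γ n a ω t G} := by
  intro hmem
  have hγγ := const_mul_const_mul h.chain h.length_ne_zero (l := l)
  obtain ⟨z, hz⟩ := Ideal.mem_span_singleton.1 hmem
  obtain ⟨v, hv, u, w, hu, rfl⟩ := h.exists_eq_pow_mul_unit z
  obtain ⟨u', hu'⟩ := hu.exists_right_inv
  obtain ⟨y, hy⟩ := h.binom_pow
  rw [monicGenerator] at hz
  set b := binom n a (n * q) l with hb
  set c := const γ (n * q) l with hc
  -- Multiplying `hz` by the inverse of `u` shows `f ^ (ω + v) ∈ γ 𝒦`.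
  have h1 : q ≤ ω + v := by
    refine h.le_of_binom_pow_eq (w := u' * (1 - b ^ t * G * (b ^ v * u + c * w) - b ^ ω * w)) ?_
    rw [← hb, ← hc, pow_add]
    linear_combination (-(b ^ ω * b ^ v)) * hu' - u' * hz
  have h2 : b ^ ω * b ^ v = c * b * (y * b ^ (ω + v - q)) := by
    rw [← pow_add, ← Nat.add_sub_cancel' h1, pow_add, hy]
    rw [Nat.add_sub_cancel_left]
    ring
  have h3 : b ^ ω = b * b ^ (ω - 1) := by rw [← pow_succ', Nat.sub_add_cancel hω0]
  have h4 : b ^ v = b * b ^ (v - 1) := by rw [← pow_succ', Nat.sub_add_cancel (by omega)]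
  -- Every term of the product equal to `γ` carries `γ f`: the leading one by `binom_pow`, the
  -- others since `ω, v ≥ 1`. As `f` is nilpotent, the cofactor of `γ` is a unit, forcing `γ = 0`.
  have h5 : c * (1 - b * (y * b ^ (ω + v - q) * u + b ^ (ω - 1) * w +
      b ^ t * G * b ^ (v - 1) * u)) = 0 := by
    linear_combination hz + u * h2 + c * w * h3 + c * b ^ t * G * u * h4 + b ^ t * G * hγγ w
  have h6 : IsUnit (1 - b * (y * b ^ (ω + v - q) * u + b ^ (ω - 1) * w +
      b ^ t * G * b ^ (v - 1) * u)) :=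
    IsNilpotent.isUnit_one_sub ((Commute.all _ _).isNilpotent_mul_right h.isNilpotent_binom)
  exact h.const_ne_zero (h6.mul_left_eq_zero.1 h5)

end IsPrimaryModulus

/-! ### Digit expansions in powers of `x ^ n - a`, and the classification. -/

/-- `S` contains exactly one representative of each residue class, and `0` represents `0`. -/
structure IsRepresentativeSet {R : Type*} [CommRing R] [IsLocalRing R] (S : Set R) : Prop where
  zero_mem : 0 ∈ S
  exists_residue_eq : ∀ r : R, ∃ t ∈ S, residue R t = residue R r
  eq_zero_of_residue : ∀ t ∈ S, residue R t = 0 → t = 0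

section Digits

variable {R : Type*} [CommRing R] [IsLocalRing R] {γ a l : R} {n q : ℕ} {S : Set R}

theorem IsRepresentativeSet.exists_boundedPolys (hS : IsRepresentativeSet S) (hn : 0 < n)
    {g : R[X]} (hg : g.degree < n) :
    ∃ A ∈ boundedPolys n S, A.map (residue R) = g.map (residue R) := by
  choose r hr hr' using hS.exists_residue_eq
  set A : R[X] := ∑ i ∈ Finset.range n, monomial i (r (g.coeff i)) with hA
  have hcoeff : ∀ i, A.coeff i = if i < n then r (g.coeff i) else 0 := by
    intro i
    simp only [hA, finsetSum_coeff, coeff_monomial, Finset.sum_ite_eq', Finset.mem_range]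
  refine ⟨A, ⟨fun i => ?_, Or.inr ?_⟩, ?_⟩
  · rw [hcoeff]
    split_ifs
    · exact hr _
    · exact hS.zero_mem
  · rw [← Nat.le_sub_one_iff_lt hn, natDegree_le_iff_coeff_eq_zero]
    intro i hi
    rw [hcoeff, if_neg (by omega)]
  · ext i
    rw [coeff_map, coeff_map, hcoeff]
    split_ifs with hi
    · exact hr' _
    · rw [(degree_lt_iff_coeff_zero _ _).1 hg i (by omega)]

namespace IsPrimaryModulus

theorem exists_digits (h : IsPrimaryModulus γ n q a l) (hS : IsRepresentativeSet S)
    (z : CodeRing (n * q) l) (b : ℕ) : ∃ A : ℕ → R[X], (∀ i, A i ∈ boundedPolys n S) ∧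
      ∃ y w, z = ∑ i ∈ Finset.range b, AdjoinRoot.mk _ (A i) * binom n a (n * q) l ^ i +
        binom n a (n * q) l ^ b * y + const γ (n * q) l * w := by
  induction b with
  | zero =>
    exact ⟨fun _ => 0, fun i => ⟨fun j => by simpa using hS.zero_mem, Or.inl rfl⟩, z, 0, by simp⟩
  | succ b ih =>
    obtain ⟨A, hA, y, w, hz⟩ := ih
    obtain ⟨g, rfl⟩ := AdjoinRoot.mk_surjective y
    have hm : (X ^ n - C a : R[X]).Monic := monic_X_pow_sub_C a h.n_pos.ne'
    obtain ⟨B, hB, hBg⟩ := hS.exists_boundedPolys h.n_pos (g := g %ₘ (X ^ n - C a)) (by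
      rw [← degree_X_pow_sub_C h.n_pos a]
      exact degree_modByMonic_lt _ hm)
    -- Replacing the remainder by its digit changes it by a multiple of `γ`, which is absorbed into
    -- `w`.
    obtain ⟨e, he⟩ := h.chain.map_residue_eq_zero_iff.1
      (show (g %ₘ (X ^ n - C a) - B).map (residue R) = 0 by
        rw [Polynomial.map_sub, hBg, sub_self])
    refine ⟨Function.update A b B, ?_, AdjoinRoot.mk _ (g /ₘ (X ^ n - C a)),
      w + binom n a (n * q) l ^ b * AdjoinRoot.mk _ e, ?_⟩
    · intro i
      rcases eq_or_ne i b with rfl | hi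
      · rwa [Function.update_self]
      · rw [Function.update_of_ne hi]
        exact hA i
    · have h1 : ∑ i ∈ Finset.range b, AdjoinRoot.mk (X ^ (n * q) - C l) (Function.update A b B i) *
          binom n a (n * q) l ^ i =
          ∑ i ∈ Finset.range b, AdjoinRoot.mk _ (A i) * binom n a (n * q) l ^ i := by
        refine Finset.sum_congr rfl fun i hi => ?_
        rw [Function.update_of_ne (Finset.mem_range.1 hi).ne]
      have h2 : AdjoinRoot.mk (X ^ (n * q) - C l) g = AdjoinRoot.mk _ B +
          const γ (n * q) l * AdjoinRoot.mk _ e +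
          binom n a (n * q) l * AdjoinRoot.mk _ (g /ₘ (X ^ n - C a)) := by
        rw [const_eq_mk, binom, ← map_mul, ← map_mul, ← map_add, ← map_add]
        congr 1
        linear_combination he - modByMonic_add_div g (X ^ n - C a)
      rw [hz, Finset.sum_range_succ, h1, Function.update_self, h2]
      ring

/-- Modulo `f̄` only the digit `A 0` survives; its reduction is nonzero of degree below `n`, hence
not divisible by `f̄`. -/
theorem isUnit_sum_digits (h : IsPrimaryModulus γ n q a l) (hS : IsRepresentativeSet S)
    {A : ℕ → R[X]} (hA : A 0 ∈ boundedPolys n S) (hA0 : A 0 ≠ 0) {b : ℕ} (hb : 0 < b) :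
    IsUnit (∑ i ∈ Finset.range b, AdjoinRoot.mk (X ^ (n * q) - C l) (A i) *
      binom n a (n * q) l ^ i) := by
  obtain ⟨b, rfl⟩ := Nat.exists_eq_succ_of_ne_zero hb.ne'
  have : ∑ i ∈ Finset.range (b + 1), AdjoinRoot.mk (X ^ (n * q) - C l) (A i) *
      binom n a (n * q) l ^ i =
      AdjoinRoot.mk _ (A 0 + (X ^ n - C a) * ∑ i ∈ Finset.range b, A (i + 1) * (X ^ n - C a) ^ i) := by
    rw [Finset.sum_range_succ', map_add, map_mul, map_sum, Finset.mul_sum, add_comm, pow_zero,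
      mul_one]
    congr 1
    refine Finset.sum_congr rfl fun i _ => ?_
    rw [binom, pow_succ, map_mul, map_pow]
    ring
  rw [Nat.succ_eq_add_one, this]
  apply h.isUnit_mk
  rw [Polynomial.map_add, Polynomial.map_mul, Polynomial.map_sub, Polynomial.map_pow, map_X, map_C,
    dvd_add_left (dvd_mul_right _ _)]
  intro hdvd
  have hzero : (A 0).map (residue R) = 0 := by
    refine eq_zero_of_dvd_of_degree_lt hdvd ?_
    rw [degree_X_pow_sub_C h.n_pos]
    refine degree_map_le.trans_lt ?_
    rw [← natDegree_lt_iff_degree_lt hA0]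
    exact hA.2.resolve_left hA0
  apply hA0
  ext i
  rw [coeff_zero]
  refine hS.eq_zero_of_residue _ (hA.1 i) ?_
  rw [← coeff_map, hzero, coeff_zero]

theorem exists_reducedUnit (h : IsPrimaryModulus γ n q a l) (hS : IsRepresentativeSet S)
    (z : CodeRing (n * q) l) (μ : ℕ) : ∃ t G y w,
      z = binom n a (n * q) l ^ t * G + binom n a (n * q) l ^ μ * y + const γ (n * q) l * w ∧
      (G = 0 ∨ (t < μ ∧ IsReducedUnit S n a (μ - t) G)) := by
  classical
  obtain ⟨A, hA, y, w, hz⟩ := h.exists_digits hS z μ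
  by_cases hex : ∃ t, t < μ ∧ A t ≠ 0
  -- The first nonzero digit sits at `t`; factoring out `f ^ t` leaves a sum whose lowest digit is
  -- nonzero.
  · set t := Nat.find hex with ht
    obtain ⟨htμ, hAt⟩ : t < μ ∧ A t ≠ 0 := Nat.find_spec hex
    have hmin : ∀ i < t, A i = 0 := by
      intro i hi
      by_contra hne
      exact Nat.find_min hex hi ⟨hi.trans htμ, hne⟩
    refine ⟨t, ∑ i ∈ Finset.range (μ - t), AdjoinRoot.mk _ (A (t + i)) * binom n a (n * q) l ^ i,
      y, w, ?_, Or.inr ⟨htμ, h.isUnit_sum_digits hS (A := fun i => A (t + i)) (hA _) hAt (by omega),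
        fun i => A (t + i), fun i _ => hA _, rfl⟩⟩
    rw [hz]
    congr 2
    conv_lhs => rw [← Nat.add_sub_cancel' htμ.le, Finset.sum_range_add]
    rw [Finset.sum_eq_zero, zero_add, Finset.mul_sum]
    · refine Finset.sum_congr rfl fun i _ => ?_
      rw [pow_add]
      ring
    · intro i hi
      rw [hmin i (Finset.mem_range.1 hi), map_zero, zero_mul]
  · push Not at hex
    refine ⟨0, 0, y, w, ?_, Or.inl rfl⟩
    rw [hz, Finset.sum_eq_zero, mul_zero]
    intro i hi
    rw [hex i (Finset.mem_range.1 hi), map_zero, zero_mul]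

/-- Every constacyclic code is of one of the four types. -/
theorem classification (h : IsPrimaryModulus γ n q a l) (hS : IsRepresentativeSet S)
    (𝒞 : Ideal (CodeRing (n * q) l)) :
    IsTypeI 𝒞 ∨ (∃ τ, IsTypeII γ q n a 𝒞 τ) ∨ (∃ ω t κ G, IsTypeIII γ S q n a 𝒞 ω t κ G) ∨
      (∃ ω t κ μ G, IsTypeIV γ S q n a 𝒞 ω t κ μ G) := by
  have hγγ := const_mul_const_mul h.chain h.length_ne_zero (l := l)
  obtain ⟨y, hy⟩ := h.binom_pow
  have least : ∀ 𝒥 : Ideal (CodeRing (n * q) l), ∃ j ≤ q,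
      IsLeast {k | const γ (n * q) l * binom n a (n * q) l ^ k ∈ 𝒥} j := by
    intro 𝒥
    have hq : q ∈ {k | const γ (n * q) l * binom n a (n * q) l ^ k ∈ 𝒥} := by
      rw [Set.mem_ofPred_eq, hy, hγγ]
      exact 𝒥.zero_mem
    exact ⟨_, Nat.sInf_le hq, Nat.sInf_mem ⟨q, hq⟩, fun k hk => Nat.sInf_le hk⟩
  obtain ⟨μ, hμq, hμ⟩ := least 𝒞
  have torsion : ∀ z, const γ (n * q) l * z ∈ 𝒞 →
      const γ (n * q) l * z ∈ Ideal.span {const γ (n * q) l * binom n a (n * q) l ^ μ} := fun z hz =>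
    (h.const_mul_mem_span_const_mul μ z).2 ((h.const_mul_mem_of_isLeast hμ z).1 hz)
  have hΩ : q ∈ {k | ∃ w, binom n a (n * q) l ^ k + const γ (n * q) l * w ∈ 𝒞} := by
    refine ⟨-(binom n a (n * q) l * y), ?_⟩
    rw [hy, mul_neg, add_neg_cancel]
    exact 𝒞.zero_mem
  obtain ⟨ω, hω⟩ : ∃ ω, IsLeast {k | ∃ w, binom n a (n * q) l ^ k + const γ (n * q) l * w ∈ 𝒞} ω :=
    ⟨_, Nat.sInf_mem ⟨q, hΩ⟩, fun k hk => Nat.sInf_le hk⟩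
  have hωq : ω ≤ q := hω.2 hΩ
  have hdecomp : ∀ c ∈ 𝒞, ∃ v ≤ q, ω ≤ v ∧ ∃ u w,
      c = binom n a (n * q) l ^ v * u + const γ (n * q) l * w := by
    intro c hc
    obtain ⟨v, hv, u, w, hu, rfl⟩ := h.exists_eq_pow_mul_unit c
    obtain ⟨u', hu'⟩ := hu.exists_right_inv
    refine ⟨v, hv, hω.2 ⟨w * u', ?_⟩, u, w, rfl⟩
    convert 𝒞.mul_mem_right u' hc using 1
    linear_combination (-binom n a (n * q) l ^ v) * hu'
  obtain ⟨w₀, hw₀⟩ := hω.1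
  rcases Nat.eq_zero_or_pos ω with rfl | hω0
  · refine Or.inl (Or.inr (𝒞.eq_top_of_isUnit_mem hw₀ ?_))
    apply h.isUnit_of_reduction
    rw [pow_zero, map_add, map_one, reduction_const_mul h.chain h.length_ne_zero, add_zero]
    exact isUnit_one
  rcases hωq.eq_or_lt with rfl | hωq
  -- For `ω = q` every codeword is a multiple of `γ`, so the torsion determines the code.
  · have h𝒞 : 𝒞 = Ideal.span {const γ (n * ω) l * binom n a (n * ω) l ^ μ} := by
      apply le_antisymm
      · intro c hc
        obtain ⟨v, hv, hv', u, w, rfl⟩ := hdecomp c hc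
        obtain rfl := le_antisymm hv hv'
        rw [hy, mul_assoc, ← mul_add] at hc ⊢
        exact torsion _ hc
      · rw [Ideal.span_singleton_le_iff_mem]
        exact hμ.1
    rcases hμq.eq_or_lt with rfl | hμq
    · left
      left
      rw [h𝒞, hy, hγγ, Ideal.span_singleton_eq_bot]
    · exact Or.inr (Or.inl ⟨μ, hμq, h𝒞⟩)
  right
  right
  obtain ⟨t, G, y', w', hw', hG⟩ := h.exists_reducedUnit hS w₀ μ
  have hμmem : const γ (n * q) l * binom n a (n * q) l ^ μ ∈ 𝒞 := hμ.1
  have hgen : monicGenerator γ n a ω t G ∈ 𝒞 := by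
    convert 𝒞.sub_mem hw₀ (𝒞.mul_mem_right y' hμmem) using 1
    rw [monicGenerator, hw']
    linear_combination -hγγ w'
  have h𝒞 : 𝒞 = Ideal.span {monicGenerator γ n a ω t G,
      const γ (n * q) l * binom n a (n * q) l ^ μ} := by
    apply le_antisymm
    · intro c hc
      obtain ⟨v, hv, hv', u, w, rfl⟩ := hdecomp c hc
      have h1 := 𝒞.sub_mem hc (𝒞.mul_mem_right (binom n a (n * q) l ^ (v - ω) * u) hgen)
      have h2 : binom n a (n * q) l ^ v = binom n a (n * q) l ^ ω * binom n a (n * q) l ^ (v - ω) := by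
        rw [← pow_add, Nat.add_sub_cancel' hv']
      have h3 : binom n a (n * q) l ^ v * u + const γ (n * q) l * w -
          monicGenerator γ n a ω t G * (binom n a (n * q) l ^ (v - ω) * u) = const γ (n * q) l *
          (w - binom n a (n * q) l ^ t * G * (binom n a (n * q) l ^ (v - ω) * u)) := by
        rw [monicGenerator]
        linear_combination u * h2
      rw [h3] at h1
      obtain ⟨e, he⟩ := Ideal.mem_span_singleton.1 (torsion _ h1)
      rw [← h3] at he
      exact Ideal.mem_span_pair.2 ⟨binom n a (n * q) l ^ (v - ω) * u, e, by linear_combination -he⟩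
    · rw [Ideal.span_le]
      rintro x (rfl | rfl)
      · exact hgen
      · exact hμmem
  obtain ⟨κ, -, hκ⟩ := least (Ideal.span {monicGenerator γ n a ω t G})
  have hκω : κ ≤ ω := by
    -- Multiplying the generator by `γ` kills its second term and leaves `γ f ^ ω`.
    refine hκ.2 (Ideal.mem_span_singleton.2 ⟨const γ (n * q) l, ?_⟩)
    rw [monicGenerator]
    linear_combination -hγγ (binom n a (n * q) l ^ t * G)
  have hμκ : μ ≤ κ := hμ.2 ((Ideal.span_singleton_le_iff_mem _).2 hgen hκ.1)
  rcases hμκ.eq_or_lt with rfl | hμκ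
  · refine Or.inl ⟨ω, t, μ, G, hω0, hωq, hκω, hκ, hG, h𝒞.trans (le_antisymm ?_ ?_)⟩
    · rw [Ideal.span_le]
      rintro x (rfl | rfl)
      · exact Ideal.mem_span_singleton_self _
      · exact hκ.1
    · exact Ideal.span_mono (by simp)
  · exact Or.inr ⟨ω, t, κ, μ, G, hμκ, hκω, hωq, hκ, hG, h𝒞⟩

end IsPrimaryModulus

end Digits

/-! ### From the hypotheses on `α₀` and `ζ` to the abstract setting. -/

section Hypotheses

variable {R : Type*} [CommRing R] [IsLocalRing R] {γ : R}

/-- Hensel lifting: separability makes the factors of `f̄` coprime, and since `γ² = 0` a single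
correction by Bézout coefficients lifts the factorization exactly. -/
theorem irreducible_map_residue (hR : IsChainRingWith R γ 2) {f : R[X]} (hf : Irreducible f)
    (hsep : (f.map (residue R)).Separable) (hu : ¬ IsUnit (f.map (residue R))) :
    Irreducible (f.map (residue R)) := by
  refine ⟨hu, fun g h hgh => ?_⟩
  obtain ⟨g, rfl⟩ := map_surjective (residue R) residue_surjective g
  obtain ⟨h, rfl⟩ := map_surjective (residue R) residue_surjective h
  obtain ⟨u, v, huv⟩ : IsCoprime (g.map (residue R)) (h.map (residue R)) := by
    rw [hgh] at hsep
    exact hsep.isCoprime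
  obtain ⟨u, rfl⟩ := map_surjective (residue R) residue_surjective u
  obtain ⟨v, rfl⟩ := map_surjective (residue R) residue_surjective v
  obtain ⟨e, he⟩ := hR.map_residue_eq_zero_iff.1 (show (f - g * h).map (residue R) = 0 by
    rw [Polynomial.map_sub, Polynomial.map_mul, hgh, sub_self])
  obtain ⟨d, hd⟩ := hR.map_residue_eq_zero_iff.1 (show (u * g + v * h - 1).map (residue R) = 0 by
    rw [Polynomial.map_sub, Polynomial.map_add, Polynomial.map_mul, Polynomial.map_mul, huv,
      Polynomial.map_one, sub_self])
  have hγ : (C γ * C γ : R[X]) = 0 := by rw [← C_mul, hR.mul_self, C_0]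
  have hfac : f = (g + C γ * (v * e)) * (h + C γ * (u * e)) := by
    linear_combination he - C γ * e * hd - (d * e + v * u * e ^ 2) * hγ
  have hmap : ∀ x y : R[X], (x + C γ * y).map (residue R) = x.map (residue R) := by
    intro x y
    rw [Polynomial.map_add, Polynomial.map_mul, map_C, hR.residue_self, C_0, zero_mul, add_zero]
  rcases hf.isUnit_or_isUnit hfac with h1 | h1
  · left
    rw [← hmap g (v * e)]
    exact h1.map (mapRingHom (residue R))
  · right
    rw [← hmap h (u * e)]
    exact h1.map (mapRingHom (residue R))

/-- The two sides agree modulo `γ` and both vanish at `a`, so the error `γ w` satisfies `γ w(a) =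
0`. This is what gives the extra factor `X - a`. -/
theorem exists_sub_pow_eq (hR : IsChainRingWith R γ 2) (p : ℕ) [Fact p.Prime]
    [CharP (ResidueField R) p] (a : R) (s : ℕ) :
    ∃ g : R[X], (X - C a) ^ p ^ s = X ^ p ^ s - C (a ^ p ^ s) + C γ * ((X - C a) * g) := by
  have hp : p.Prime := Fact.out
  obtain ⟨w, hw⟩ := hR.map_residue_eq_zero_iff.1
    (show ((X - C a) ^ p ^ s - (X ^ p ^ s - C (a ^ p ^ s)) : R[X]).map (residue R) = 0 by
      simp only [Polynomial.map_sub, Polynomial.map_pow, map_X, map_C, map_pow]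
      rw [sub_pow_char_pow, sub_self])
  obtain ⟨g, hg⟩ := X_sub_C_dvd_sub_C_eval (a := a) (p := w)
  refine ⟨g, ?_⟩
  have h1 : γ * w.eval a = 0 := by
    have := congrArg (eval a) hw
    simpa [zero_pow (pow_pos hp.pos s).ne'] using this.symm
  have h2 : (C γ * C (w.eval a) : R[X]) = 0 := by rw [← C_mul, h1, C_0]
  linear_combination hw + C γ * hg + h2

theorem isPrimaryModulus (hR : IsChainRingWith R γ 2) {p : ℕ} [Fact p.Prime]
    [CharP (ResidueField R) p] {n : ℕ} (hn : 0 < n) (hnp : n.Coprime p) (s : ℕ) {a : R}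
    (ha : residue R a ≠ 0) (hirr : Irreducible (X ^ n - C a : R[X])) :
    IsPrimaryModulus γ n (p ^ s) a (a ^ p ^ s) := by
  have hp : p.Prime := Fact.out
  have hmap : (X ^ n - C a : R[X]).map (residue R) = X ^ n - C (residue R a) := by
    rw [Polynomial.map_sub, Polynomial.map_pow, map_X, map_C]
  refine ⟨hR, hn, pow_pos hp.pos s, ?_, ?_, ?_⟩
  · rw [← hmap]
    refine irreducible_map_residue hR hirr ?_ ?_ <;> rw [hmap]
    · refine separable_X_pow_sub_C' p n _ (fun h => ?_) ha
      exact hp.one_lt.ne' (Nat.eq_one_of_dvd_coprimes hnp h dvd_rfl)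
    · intro h
      have := degree_eq_zero_of_isUnit h
      rw [degree_X_pow_sub_C hn] at this
      exact hn.ne' (by exact_mod_cast this)
  · rw [sub_pow_char_pow, ← pow_mul, map_pow, C_pow]
  · obtain ⟨g, hg⟩ := exists_sub_pow_eq hR p a s
    -- Substituting `X ^ n` for `X` turns the linear identity into the one for `x ^ n - a`.
    refine ⟨AdjoinRoot.mk _ (g.comp (X ^ n)), ?_⟩
    have h1 := congrArg (fun f => f.comp (X ^ n)) hg
    simp only [add_comp, sub_comp, mul_comp, pow_comp, X_comp, C_comp, ← pow_mul] at h1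
    rw [binom, const_eq_mk, ← map_pow, h1, map_add, AdjoinRoot.mk_self, zero_add, map_mul, map_mul]

/-- If `ζ ^ k` reduces to `1`, it equals `1 + γ c`, whose `p`-th power is `1 + p γ c = 1` because `p
γ = 0`. Coprimality to `p` then removes the factor `p`. -/
theorem orderOf_residue_of_coprime (hR : IsChainRingWith R γ 2) (p : ℕ)
    [CharP (ResidueField R) p] {ζ : R} (hζ : (orderOf ζ).Coprime p) :
    orderOf (residue R ζ) = orderOf ζ := by
  refine Nat.dvd_antisymm (orderOf_map_dvd (residue R : R →* ResidueField R) ζ) ?_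
  obtain ⟨c, hc⟩ := hR.residue_eq_zero_iff.1
    (show residue R (ζ ^ orderOf (residue R ζ) - 1) = 0 by
      rw [map_sub, map_pow, pow_orderOf_eq_one, map_one, sub_self])
  have hpow : ∀ k : ℕ, (1 + γ * c) ^ k = 1 + k * (γ * c) := by
    intro k
    induction k with
    | zero => simp
    | succ k ih =>
      rw [pow_succ, ih]
      push_cast
      linear_combination k * c ^ 2 * hR.mul_self
  have hpγ : γ * (p : R) = 0 := by
    rw [hR.mul_eq_zero_iff, map_natCast, CharP.cast_eq_zero]
  refine hζ.dvd_of_dvd_mul_right (orderOf_dvd_of_pow_eq_one ?_)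
  rw [pow_mul, show ζ ^ orderOf (residue R ζ) = 1 + γ * c by linear_combination hc, hpow]
  linear_combination c * hpγ

theorem exists_pow_eq_of_orderOf {F : Type*} [Field F] [Finite F] {x : F}
    (hx : orderOf x = Nat.card F - 1) {y : F} (hy : y ≠ 0) : ∃ i < orderOf x, x ^ i = y := by
  have hpos : 0 < orderOf x := by
    rw [hx]
    have := Finite.one_lt_card (α := F)
    omega
  have hu : IsUnit x := IsUnit.of_pow_eq_one (pow_orderOf_eq_one x) hpos.ne'
  obtain ⟨u, rfl⟩ := hu
  have htop : Subgroup.zpowers u = ⊤ := by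
    apply Subgroup.eq_top_of_card_eq
    rw [Nat.card_zpowers, Nat.card_units, ← hx, orderOf_units]
  have hmem : Units.mk0 y hy ∈ Subgroup.zpowers u := htop ▸ Subgroup.mem_top _
  rw [← mem_powers_iff_mem_zpowers, Submonoid.mem_powers_iff] at hmem
  obtain ⟨i, hi⟩ := hmem
  refine ⟨i % orderOf (u : F), Nat.mod_lt _ hpos, ?_⟩
  rw [pow_mod_orderOf, ← Units.val_pow_eq_pow_val, hi, Units.val_mk0]

theorem isRepresentativeSet_teichmullerSet [Finite (ResidueField R)] {ζ : R} (hζ : 0 < orderOf ζ)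
    (hres : orderOf (residue R ζ) = orderOf ζ)
    (hcard : orderOf ζ = Nat.card (ResidueField R) - 1) :
    IsRepresentativeSet (teichmullerSet ζ) := by
  refine ⟨Or.inl rfl, fun r => ?_, ?_⟩
  · by_cases h : residue R r = 0
    · exact ⟨0, Or.inl rfl, by rw [map_zero, h]⟩
    · obtain ⟨i, hi, hi'⟩ := exists_pow_eq_of_orderOf (hres.trans hcard) h
      exact ⟨ζ ^ i, Or.inr ⟨i, hres ▸ hi, rfl⟩, by rw [map_pow, hi']⟩
  · rintro t (rfl | ⟨i, -, rfl⟩) ht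
    · rfl
    · have hu : IsUnit ζ := IsUnit.of_pow_eq_one (pow_orderOf_eq_one ζ) hζ.ne'
      exact absurd ht ((hu.pow i).map (residue R)).ne_zero

end Hypotheses

end ConstacyclicCode

/-! ### Assembly of the classification and the distances. -/

theorem theorem3p6 {R : Type*} [CommRing R] [Finite R] [IsLocalRing R] (γ : R)
    (hR : ConstacyclicCode.IsChainRingWith R γ 2)
    (p m : ℕ) (hp : p.Prime) (hm : 0 < m)
    (hcard : Nat.card (IsLocalRing.ResidueField R) = p ^ m)
    (ζ : R) (hζ : orderOf ζ = p ^ m - 1)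
    (n s : ℕ) (hn : 0 < n) (hs : 0 < s) (hnp : Nat.Coprime n p)
    (α₀ α : R) (hα₀ : α₀ ∈ ConstacyclicCode.teichmullerSet ζ)
    (hα : α ∈ ConstacyclicCode.teichmullerSet ζ \ {0}) (hαα₀ : α = α₀ ^ p ^ s)
    (hirr : Irreducible (X ^ n - C α₀ : R[X]))
    (𝒞 : Ideal (ConstacyclicCode.CodeRing (n * p ^ s) α)) :
    -- every code is of one of the four types
    (ConstacyclicCode.IsTypeI 𝒞 ∨
      (∃ τ, ConstacyclicCode.IsTypeII γ (p ^ s) n α₀ 𝒞 τ) ∨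
      (∃ ω t κ G, ConstacyclicCode.IsTypeIII γ (ConstacyclicCode.teichmullerSet ζ) (p ^ s) n α₀
        𝒞 ω t κ G) ∨
      (∃ ω t κ μ G, ConstacyclicCode.IsTypeIV γ (ConstacyclicCode.teichmullerSet ζ) (p ^ s) n α₀
        𝒞 ω t κ μ G)) ∧
    -- (a), (b): the trivial codes
    (𝒞 = ⊥ → ConstacyclicCode.hammingDistance 𝒞 = 0) ∧
    (𝒞 = ⊤ → ConstacyclicCode.hammingDistance 𝒞 = 1) ∧
    -- (c): Type II
    (∀ τ, ConstacyclicCode.IsTypeII γ (p ^ s) n α₀ 𝒞 τ →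
      ConstacyclicCode.hammingDistance 𝒞 = ConstacyclicCode.hammingDistance
        (Ideal.span {ConstacyclicCode.binom n (IsLocalRing.residue R α₀) (n * p ^ s)
          (IsLocalRing.residue R α) ^ τ}) ∧
      ((τ = 0 ∧ ConstacyclicCode.hammingDistance 𝒞 = 1) ∨
        ConstacyclicCode.PiecewiseDistance p s τ (ConstacyclicCode.hammingDistance 𝒞))) ∧
    -- (d): Type III
    (∀ ω t κ G, ConstacyclicCode.IsTypeIII γ (ConstacyclicCode.teichmullerSet ζ) (p ^ s) n α₀
        𝒞 ω t κ G →
      ConstacyclicCode.hammingDistance 𝒞 = ConstacyclicCode.hammingDistance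
        (Ideal.span {ConstacyclicCode.binom n (IsLocalRing.residue R α₀) (n * p ^ s)
          (IsLocalRing.residue R α) ^ κ}) ∧
      ConstacyclicCode.PiecewiseDistance p s κ (ConstacyclicCode.hammingDistance 𝒞)) ∧
    -- (e): Type IV
    (∀ ω t κ μ G, ConstacyclicCode.IsTypeIV γ (ConstacyclicCode.teichmullerSet ζ) (p ^ s) n α₀
        𝒞 ω t κ μ G →
      ConstacyclicCode.hammingDistance 𝒞 = ConstacyclicCode.hammingDistance
        (Ideal.span {ConstacyclicCode.binom n (IsLocalRing.residue R α₀) (n * p ^ s)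
          (IsLocalRing.residue R α) ^ μ}) ∧
      ((μ = 0 ∧ ConstacyclicCode.hammingDistance 𝒞 = 1) ∨
        ConstacyclicCode.PiecewiseDistance p s μ (ConstacyclicCode.hammingDistance 𝒞))) := by
  have hfact : Fact p.Prime := ⟨hp⟩
  have hfin : Finite (IsLocalRing.ResidueField R) :=
    Finite.of_surjective _ IsLocalRing.residue_surjective
  have hchar : CharP (IsLocalRing.ResidueField R) p := by
    have := Fintype.ofFinite (IsLocalRing.ResidueField R)
    exact charP_of_card_eq_prime_pow (Fintype.card_eq_nat_card.trans hcard)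
  have hq : 1 < p ^ m := Nat.one_lt_pow hm.ne' hp.one_lt
  have hζ0 : 0 < orderOf ζ := by omega
  have hζp : (orderOf ζ).Coprime p := by
    have h1 : (p ^ m - 1).Coprime (p ^ m - 1 + 1) := by simp
    rw [Nat.sub_add_cancel hq.le] at h1
    rw [hζ]
    exact h1.coprime_dvd_right (dvd_pow_self p hm.ne')
  have hS := ConstacyclicCode.isRepresentativeSet_teichmullerSet hζ0
    (ConstacyclicCode.orderOf_residue_of_coprime hR p hζp) (by rw [hζ, hcard])
  have hα₀0 : IsLocalRing.residue R α₀ ≠ 0 := by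
    intro h
    apply hα.2
    rw [hαα₀, hS.eq_zero_of_residue _ hα₀ h, zero_pow (pow_pos hp.pos s).ne']
    rfl
  subst hαα₀
  have hM := ConstacyclicCode.isPrimaryModulus hR hn hnp s hα₀0 hirr
  have hres : IsLocalRing.residue R (α₀ ^ p ^ s) = IsLocalRing.residue R α₀ ^ p ^ s := map_pow _ _ _
  -- Types II, III and IV differ only in how their torsion code is identified as `⟨f̄ ^ j⟩`; the
  -- distance argument is common.
  have hdist : ∀ j, j < p ^ s → (∀ z, ConstacyclicCode.const γ (n * p ^ s) (α₀ ^ p ^ s) * z ∈ 𝒞 ↔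
      ConstacyclicCode.reduction (n * p ^ s) (α₀ ^ p ^ s) z ∈
        Ideal.span {ConstacyclicCode.binom n (IsLocalRing.residue R α₀) (n * p ^ s)
          (IsLocalRing.residue R (α₀ ^ p ^ s)) ^ j}) →
      ConstacyclicCode.hammingDistance 𝒞 = ConstacyclicCode.hammingDistance
        (Ideal.span {ConstacyclicCode.binom n (IsLocalRing.residue R α₀) (n * p ^ s)
          (IsLocalRing.residue R (α₀ ^ p ^ s)) ^ j}) ∧
      ((j = 0 ∧ ConstacyclicCode.hammingDistance 𝒞 = 1) ∨
        ConstacyclicCode.PiecewiseDistance p s j (ConstacyclicCode.hammingDistance 𝒞)) := by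
    intro j hj H
    have heq := ConstacyclicCode.hammingDistance_eq_of_torsion hR hM.length_ne_zero H
    refine ⟨heq, ?_⟩
    rw [heq]
    rcases Nat.eq_zero_or_pos j with rfl | hj0
    · refine Or.inl ⟨rfl, ?_⟩
      rw [pow_zero, Ideal.span_singleton_one]
      exact ConstacyclicCode.hammingDistance_top hM.length_ne_zero
    · right
      rw [hres]
      exact ConstacyclicCode.hammingDistance_span_binom_pow p hn hα₀0 hj0 hj
  refine ⟨hM.classification hS 𝒞, ?_, ?_, ?_, ?_, ?_⟩
  · rintro rfl
    exact ConstacyclicCode.hammingDistance_bot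
  · rintro rfl
    exact ConstacyclicCode.hammingDistance_top hM.length_ne_zero
  · rintro τ ⟨hτ, rfl⟩
    exact hdist τ hτ (hM.const_mul_mem_span_const_mul τ)
  · rintro ω t κ G ⟨hω0, hω, hκω, hκ, -, rfl⟩
    have hκ0 : κ ≠ 0 := by
      rintro rfl
      apply hM.const_notMem_span_monicGenerator hω0 hω (t := t) G
      simpa using hκ.1
    obtain ⟨h1, h2⟩ := hdist κ (by omega) (hM.const_mul_mem_of_isLeast hκ)
    exact ⟨h1, h2.resolve_left fun h => hκ0 h.1⟩
  · rintro ω t κ μ G ⟨hμκ, hκω, hω, hκ, -, rfl⟩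
    exact hdist μ (by omega) (hM.const_mul_mem_span_pair hμκ.le hκ)
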